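/- Let $(X,d,m)$ be a metric measure space in which all bounded closed sets are compact and $m$ has full support, and let $n>0$, $d_w\ge 2$. Suppose that $X$ is Ahlfors $n$-regular: for some $C>0$, $C^{-1}r^n\le m(B(x,r))\le Cr^n$ for all $x\in X$ and $0<r<\operatorname{diam}X$. Let $Z_t$ be a diffusion process on $X$ (a Markov process, with possibly finite lifetime, whose paths are continuous up to the lifetime) having a transition density $T_t(x,y)\ge 0$ with respect to $m$ that is symmetric and continuous in $(x,y)$ and satisfies, for some constants $c_1,c_2,c_3,c_4>0$ and some $t_0\in(0,\infty]$, with $t_0=\infty$ if $X$ is unbounded, $$\frac{c_1}{t^{n/d_w}}\exp\Bigl(-c_2\Bigl(\frac{d(x,y)^{d_w}}{t}\Bigr)^{\frac1{d_w-1}}\Bigr)\le T_t(x,y)\le \frac{c_3}{t^{n/d_w}}\exp\Bigl(-c_4\Bigl(\frac{d(x,y)^{d_w}}{t}\Bigr)^{\frac1{d_w-1}}\Bigr)$$ for all $x,y\in X$ and $0<t<t_0$. Write $T_tf(x)=\mathbb E_xf(Z_t)$, where $f$ is extended by $0$ to the cemetery state, and let $\Delta$ be the Feller generator of $Z_t$: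 for $f\in C_0(X)$ (the real-valued continuous functions vanishing at infinity), $f\in\operatorname{dom}(\Delta)$ and $\Delta f=u$ if $(T_tf-f)/t\to u\in C_0(X)$ uniformly on $X$ as $t\to0^+$. Then for every integer $l\ge1$ there is a function $c(l,\cdot)$ on $(0,\infty)$, depending only on $X$ and the process $Z_t$, such that the following holds. Let $K\subseteq X$ be compact, $\varepsilon,s>0$, $g\in L^\infty(X)$ and $h=T_sg$. Then there is a function $f\in C_0(X)$ such that $f(x)=h(x)$ for $x\in K$, $f(x)=0$ whenever $\operatorname{dist}(x,K)\ge\varepsilon$, $\|f\|_{L^\infty(X)}\le\|g\|_{L^\infty(X)}$, $f\ge0$ if $g\ge0$, and, for every integer $l\ge1$, $f\in\operatorname{dom}(\Delta^l)$ and $$\|\Delta^lf\|_{L^\infty(X)}\le c\bigl(l,\varepsilon^{d_w}/s\bigr)\,\frac{(\operatorname{diam}K+\varepsilon)^{n/2}}{\varepsilon^{\,l d_w+n/2}}\,\|g\|_{L^\infty(X)}.$$ -/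

import Mathlib

open Set Filter Topology MeasureTheory
open scoped NNReal ENNReal ZeroAtInfty

/-- A diffusion process on `X`, realised on a measurable space `Ω`: a time-homogeneous Markov
process `(Z_t, ℱ_t, P_x)` with values in `X ∪ {∂}`, where the cemetery `∂` is the added point `∞`
of the one-point compactification `OnePoint X` (an isolated point when `X` is compact), which
starts at `x` under `P_x`, is absorbed by `∂`, and has paths that are continuous up to
the lifetime `inf {t : Z_t = ∂}`. (The lifetime may be infinite almost surely.) -/
structure Diffusion (X : Type*) [TopologicalSpace X] [MeasurableSpace X]
    (Ω : Type*) [mΩ : MeasurableSpace Ω] where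
  /-- the position `Z_t(ω)` -/
  path : ℝ≥0 → Ω → OnePoint X
  /-- the filtration -/
  filtration : Filtration ℝ≥0 mΩ
  /-- the law `P_x` of the process started at `x` -/
  law : X → Measure Ω
  isProbabilityMeasure : ∀ x, IsProbabilityMeasure (law x)
  adapted : ∀ (t : ℝ≥0) (A : Set X), MeasurableSet A →
    MeasurableSet[filtration t] {ω | ∃ y ∈ A, path t ω = (y : OnePoint X)}
  measurable_law : ∀ (t : ℝ≥0) (A : Set X), MeasurableSet A →
    Measurable fun x : X => law x {ω | ∃ y ∈ A, path t ω = (y : OnePoint X)}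
  start : ∀ x : X, ∀ᵐ ω ∂(law x), path 0 ω = (x : OnePoint X)
  absorbed : ∀ x, ∀ᵐ ω ∂(law x), ∀ s t : ℝ≥0, s ≤ t →
    path s ω = OnePoint.infty → path t ω = OnePoint.infty
  continuous_path : ∀ x, ∀ᵐ ω ∂(law x), ∀ t : ℝ≥0, path t ω ≠ OnePoint.infty →
    ContinuousAt (fun s => path s ω) t
  /-- the Markov property
  `P_x(F ∩ {Z_{s+t} ∈ A}) = E_x[P_{Z_s}(Z_t ∈ A); F]` for `F ∈ ℱ_s` and Borel `A ⊆ X` -/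
  markov : ∀ (x : X) (s t : ℝ≥0) (F : Set Ω), MeasurableSet[filtration s] F →
    ∀ A : Set X, MeasurableSet A →
      law x (F ∩ {ω | ∃ y ∈ A, path (s + t) ω = (y : OnePoint X)}) =
        ∫⁻ ω in F, (path s ω).elim 0
          (fun z => law z {ω' | ∃ y ∈ A, path t ω' = (y : OnePoint X)}) ∂(law x)

namespace Diffusion

variable {X : Type*} [TopologicalSpace X] [MeasurableSpace X] {Ω : Type*} [MeasurableSpace Ω]

/-- The transition operator `T_t f(x) = E_x f(Z_t)`, where `f` is extended by `f(∂) = 0`. -/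
noncomputable def semigroup (Z : Diffusion X Ω) (t : ℝ≥0) (f : X → ℝ) (x : X) : ℝ :=
  ∫ ω, (Z.path t ω).elim 0 f ∂(Z.law x)

/-- `p` is a transition density of `Z` with respect to `m`:
`P_x(Z_t ∈ A) = ∫_A p_t(x, y) m(dy)` for `t > 0`. -/
structure IsTransitionDensity (Z : Diffusion X Ω) (m : Measure X) (p : ℝ≥0 → X → X → ℝ) :
    Prop where
  nonneg : ∀ t : ℝ≥0, 0 < t → ∀ x y, 0 ≤ p t x y
  law_eq : ∀ t : ℝ≥0, 0 < t → ∀ (x : X) (A : Set X), MeasurableSet A →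
    Z.law x {ω | ∃ y ∈ A, Z.path t ω = (y : OnePoint X)} =
      ∫⁻ y in A, ENNReal.ofReal (p t x y) ∂m

/-- `f` belongs to the domain of the Feller (i.e. `C₀(X)`) generator `Δ` of `Z`, and `Δ f = u`:
`(T_t f - f) / t` tends to `u` uniformly on `X` as `t → 0+`. -/
def HasGenerator (Z : Diffusion X Ω) (f u : C₀(X, ℝ)) : Prop :=
  TendstoUniformly (fun (t : ℝ≥0) (x : X) => (Z.semigroup t f x - f x) / (t : ℝ)) u
    (𝓝[>] (0 : ℝ≥0))

/-- `f` belongs to the domain of `Δ^l`, and `Δ^l f = u`. -/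
def HasGeneratorPow (Z : Diffusion X Ω) : ℕ → C₀(X, ℝ) → C₀(X, ℝ) → Prop
  | 0, f, u => u = f
  | l + 1, f, u => ∃ v : C₀(X, ℝ), HasGeneratorPow Z l f v ∧ Z.HasGenerator v u

end Diffusion

/-- Ahlfors `n`-regularity: `C⁻¹ rⁿ ≤ m(B(x, r)) ≤ C rⁿ` for `x ∈ X` and `0 < r < diam X`
(for all `r > 0` when `X` is unbounded). -/
def AhlforsRegular {X : Type*} [MetricSpace X] [MeasurableSpace X] (m : Measure X) (n : ℝ) :
    Prop :=
  ∃ C : ℝ, 0 < C ∧ ∀ (x : X) (r : ℝ), 0 < r →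
    ENNReal.ofReal r < Metric.ediam (Set.univ : Set X) →
      ENNReal.ofReal (C⁻¹ * r ^ n) ≤ m (Metric.ball x r) ∧
        m (Metric.ball x r) ≤ ENNReal.ofReal (C * r ^ n)

/-- Two-sided sub-Gaussian bounds with walk dimension `dw` on a space of dimension `n`, for all
times `0 < t < t₀`, where `t₀ = ∞` when `X` is unbounded. -/
def SubGaussianBounds {X : Type*} [MetricSpace X] (n dw : ℝ) (p : ℝ≥0 → X → X → ℝ) : Prop :=
  ∃ (c₁ c₂ c₃ c₄ : ℝ) (t₀ : ℝ≥0∞), 0 < c₁ ∧ 0 < c₂ ∧ 0 < c₃ ∧ 0 < c₄ ∧ 0 < t₀ ∧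
    (¬ Bornology.IsBounded (Set.univ : Set X) → t₀ = ∞) ∧
    ∀ t : ℝ≥0, 0 < t → (t : ℝ≥0∞) < t₀ → ∀ x y : X,
      c₁ / (t : ℝ) ^ (n / dw) *
          Real.exp (-c₂ * (dist x y ^ dw / (t : ℝ)) ^ (1 / (dw - 1))) ≤ p t x y ∧
        p t x y ≤ c₃ / (t : ℝ) ^ (n / dw) *
          Real.exp (-c₄ * (dist x y ^ dw / (t : ℝ)) ^ (1 / (dw - 1)))

/-! Multiplying `T_s g` by a cut-off function need not stay in the domain of `Δ`, so the cut-off is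
built from the heat flow itself. Put `θ = 2^(-dw)` and `t k = τ θ^(2k)` with `τ < s`. Start from
`T_{s-τ} g`; at stage `k + 1` let the function flow for time `t k - t (k+1)`, then reset it to the
true solution `T_{s - t (k+1)} g` on a neighbourhood of `K` and to `0` on a neighbourhood of the
region at distance at least `ε` from `K`. Both neighbourhoods shrink with `k`. If `φ k` is the
result and `ψ k` the jump made by the reset, then `T_{t k} φ k = ∑_{j ≤ k} T_{t j} ψ j`, and `f` is
the limit of this.

The jumps are tiny. The resetting regions recede by `ε / 2^(k+3)`, a distance that the flow crosses
in time at most `t k` with probability `O(θ^(kN))` for every `N`; hence `ψ j = O(θ^(jN))`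
(`abs_cutoffError_succ_le`). Interpolating with an `L¹` bound gives smallness in `L²`
(`eLpNorm_cutoffError_le`). The spectral bound `‖Δˡ T_t‖ ≤ l! / t^l` on `L²` (`exists_derivatives`)
and the `L² → L^∞` bound of order `t^(-n/(2 dw))` cost only a power of `1 / t j`, so for large `N`
the series for `Δˡ f` is dominated by a geometric one (`exists_smooth_cutoff`). The same tails give
`f = T_s g` on `K` and `f = 0` at distance `ε`; sup bounds and positivity survive every step.

A second-order Taylor bound uniform in `x` turns the formal derivatives into values of the Feller
generator (`hasGeneratorPow`). The generator is local because of the tails (`eq_zero_of_infDist`),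
so all `Δˡ f` have compact support and lie in `C₀`. The sub-Gaussian bounds enter through the
on-diagonal estimate, the tails (`hasTailBounds`) and the volume of a neighbourhood of `K`
(`measure_le`). When `X` is bounded and `ε` exceeds its diameter by more than `1`, no cut-off is
needed and `f = T_s g`. -/

section SelfAdjointSemigroup

/-! ### Spectral calculus for self-adjoint contraction semigroups -/

variable {H : Type*} [NormedAddCommGroup H] [InnerProductSpace ℂ H] [CompleteSpace H]

/-- A semigroup of self-adjoint contractions of a complex Hilbert space, indexed by `t > 0`. -/
structure IsSelfAdjointSemigroup (T : ℝ → H →L[ℂ] H) : Prop where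
  add : ∀ s t, 0 < s → 0 < t → T (s + t) = T s * T t
  selfAdjoint : ∀ t, 0 < t → IsSelfAdjoint (T t)
  norm_le : ∀ t, 0 < t → ‖T t‖ ≤ 1

namespace IsSelfAdjointSemigroup

variable {T : ℝ → H →L[ℂ] H} (h : IsSelfAdjointSemigroup T)
include h

lemma nonneg {t : ℝ} (ht : 0 < t) : 0 ≤ T t := by
  have h2 : T t = star (T (t / 2)) * T (t / 2) := by
    rw [(h.selfAdjoint _ (half_pos ht)).star_eq, ← h.add _ _ (half_pos ht) (half_pos ht),
      add_halves]
  rw [h2]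
  exact star_mul_self_nonneg _

lemma nat_mul {t : ℝ} (ht : 0 < t) (k : ℕ) : T ((k + 1 : ℕ) * t) = T t ^ (k + 1) := by
  induction k with
  | zero => simp
  | succ k ih =>
    have : ((k + 1 + 1 : ℕ) : ℝ) * t = (k + 1 : ℕ) * t + t := by push_cast; ring
    rw [this, h.add _ _ (by positivity) ht, ih, pow_succ _ (k + 1)]

/-- Both sides are powers of the nonnegative operator `T (1 / (j + 1))`, for which real powers
compose. -/
lemma rat_eq (k j : ℕ) : T ((k + 1 : ℕ) / (j + 1 : ℕ)) = T 1 ^ (((k + 1 : ℕ) : ℝ) / (j + 1 : ℕ)) := by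
  have hj : (0 : ℝ) < 1 / (j + 1 : ℕ) := by positivity
  have h1 : T 1 = T (1 / (j + 1 : ℕ)) ^ (j + 1) := by
    rw [← h.nat_mul hj j]; congr 1; field_simp
  have h0 := h.nonneg hj
  have h2 : T ((k + 1 : ℕ) / (j + 1 : ℕ)) = T (1 / (j + 1 : ℕ)) ^ (k + 1) := by
    rw [← h.nat_mul hj k]; congr 1; field_simp
  rw [h2, h1, ← CFC.rpow_natCast _ (j + 1) h0, ← CFC.rpow_natCast _ (k + 1) h0,
    CFC.rpow_rpow_of_exponent_nonneg _ _ _ (by positivity) (by positivity) h0]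
  congr 1
  field_simp

lemma spectrum_subset : spectrum ℝ (T 1) ⊆ Icc 0 1 := by
  intro x hx
  refine ⟨spectrum_nonneg_of_nonneg (h.nonneg one_pos) hx, ?_⟩
  rcases subsingleton_or_nontrivial H with hH | hH
  · exfalso
    have : Subsingleton (H →L[ℂ] H) := inferInstance
    rw [spectrum.of_subsingleton] at hx
    exact hx
  · have := spectrum.norm_le_norm_of_mem hx
    exact (le_abs_self x).trans (this.trans (h.norm_le 1 one_pos))

-- With `u = -t log x ≥ 0` this is `u^l / l! ≤ e^u`; at `x = 0` the factor `0 ^ t` vanishes.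
omit h in
lemma abs_rpow_mul_log_le (l : ℕ) {t x : ℝ} (ht : 0 < t) (hx : x ∈ Icc (0 : ℝ) 1) :
    |x ^ t * Real.log x ^ l| ≤ l.factorial / t ^ l := by
  rcases hx.1.eq_or_lt with rfl | h0
  · simp [Real.zero_rpow ht.ne']; positivity
  · have hy : 0 ≤ -Real.log x := by linarith [Real.log_nonpos hx.1 hx.2]
    rw [abs_mul, abs_pow, abs_of_nonneg (Real.rpow_nonneg hx.1 t), Real.rpow_def_of_pos h0,
      le_div_iff₀ (by positivity), abs_of_nonpos (by linarith)]
    have := Real.pow_div_factorial_le_exp (t * -Real.log x) (by positivity) l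
    rw [div_le_iff₀ (by positivity), mul_pow] at this
    have e : Real.exp (Real.log x * t) * Real.exp (t * -Real.log x) = 1 := by
      rw [← Real.exp_add]; simp [mul_comm]
    calc Real.exp (Real.log x * t) * (-Real.log x) ^ l * t ^ l
        = Real.exp (Real.log x * t) * (t ^ l * (-Real.log x) ^ l) := by ring
      _ ≤ Real.exp (Real.log x * t) * (Real.exp (t * -Real.log x) * l.factorial) := by gcongr
      _ = l.factorial := by rw [← mul_assoc, e, one_mul]

-- Factoring out `x^t log^l x` leaves `|e^y - 1 - y| ≤ y²` for `y = r log x ≤ 0`.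
omit h in
lemma abs_rpow_taylor_le (l : ℕ) {t r x : ℝ} (ht : 0 < t) (hr : 0 < r) (hx : x ∈ Icc (0 : ℝ) 1) :
    |x ^ (r + t) * Real.log x ^ l - x ^ t * Real.log x ^ l - r * (x ^ t * Real.log x ^ (l + 1))| ≤
      r ^ 2 * |x ^ t * Real.log x ^ (l + 2)| := by
  rcases hx.1.eq_or_lt with rfl | h0
  · simp [Real.zero_rpow ht.ne', Real.zero_rpow (add_pos hr ht).ne']
  · have hy : 0 ≤ -(r * Real.log x) := by nlinarith [Real.log_nonpos hx.1 hx.2]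
    have key : |x ^ r - 1 - r * Real.log x| ≤ (r * Real.log x) ^ 2 := by
      rw [Real.rpow_def_of_pos h0, mul_comm (Real.log x)]
      set y := r * Real.log x
      have h1 := Real.add_one_le_exp y
      rw [abs_of_nonneg (by linarith)]
      -- For `y ≤ 0` the upper bound on `e^y` comes from inverting the quadratic lower bound on
      -- `e^(-y)`.
      have h2 := Real.quadratic_le_exp_of_nonneg hy
      have h3 : Real.exp y * Real.exp (-y) = 1 := by rw [← Real.exp_add]; simp
      have h4 : Real.exp y * (1 + -y + (-y) ^ 2 / 2) ≤ 1 :=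
        (mul_le_mul_of_nonneg_left h2 (Real.exp_pos y).le).trans h3.le
      have h5 : 1 ≤ (1 + y + y ^ 2) * (1 + -y + (-y) ^ 2 / 2) := by
        have : (1 + y + y ^ 2) * (1 + -y + (-y) ^ 2 / 2) - 1 =
          y ^ 2 * (1 / 2 - y / 2 + y ^ 2 / 2) := by ring
        nlinarith [sq_nonneg y, mul_nonneg (sq_nonneg y) (by nlinarith : 0 ≤ 1 / 2 - y / 2 + y ^ 2 / 2)]
      have h6 : 0 < 1 + -y + (-y) ^ 2 / 2 := by positivity
      nlinarith
    have e : x ^ (r + t) * Real.log x ^ l - x ^ t * Real.log x ^ l -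
        r * (x ^ t * Real.log x ^ (l + 1)) =
        (x ^ t * Real.log x ^ l) * (x ^ r - 1 - r * Real.log x) := by
      rw [Real.rpow_add h0]; ring
    rw [e, abs_mul]
    calc _ ≤ |x ^ t * Real.log x ^ l| * (r * Real.log x) ^ 2 := by gcongr
      _ = _ := by
        rw [← abs_of_nonneg (sq_nonneg (r * Real.log x)), ← abs_mul]
        conv_rhs => rw [← abs_of_nonneg (sq_nonneg r), ← abs_mul]
        congr 1; ring

-- Only `0` needs care: half of the power absorbs the logarithm and the other half tends to `0`.
omit h in
lemma continuousOn_rpow_mul_log (l : ℕ) {t : ℝ} (ht : 0 < t) :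
    ContinuousOn (fun x : ℝ => x ^ t * Real.log x ^ l) (Icc 0 1) := by
  intro x hx
  rcases hx.1.eq_or_lt with rfl | h0
  · have h1 : Tendsto (fun x : ℝ => |x ^ (t / 2)| * (l.factorial / (t / 2) ^ l))
        (𝓝[Icc 0 1] 0) (𝓝 0) := by
      have : ContinuousAt (fun x : ℝ => |x ^ (t / 2)| * (l.factorial / (t / 2) ^ l)) 0 :=
        ((Real.continuousAt_rpow_const 0 (t / 2) (Or.inr (half_pos ht).le)).abs).mul
          continuousAt_const
      have h2 := this.tendsto
      simp only [Real.zero_rpow (half_pos ht).ne', abs_zero, zero_mul] at h2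
      exact h2.mono_left nhdsWithin_le_nhds
    have h3 : Tendsto (fun x : ℝ => x ^ t * Real.log x ^ l) (𝓝[Icc 0 1] 0) (𝓝 0) := by
      refine squeeze_zero_norm' ?_ h1
      filter_upwards [self_mem_nhdsWithin] with y hy
      have e : y ^ t * Real.log y ^ l = y ^ (t / 2) * (y ^ (t / 2) * Real.log y ^ l) := by
        rw [← mul_assoc, ← Real.rpow_add_of_nonneg hy.1 (half_pos ht).le (half_pos ht).le,
          add_halves]
      rw [e, norm_mul]
      gcongr
      · exact le_rfl
      · exact abs_rpow_mul_log_le l (half_pos ht) hy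
    simpa [ContinuousWithinAt, Real.zero_rpow ht.ne'] using h3
  · exact ((Real.continuousAt_rpow_const x t (Or.inl h0.ne')).mul
      ((Real.continuousAt_log h0.ne').pow l)).continuousWithinAt

omit h in
lemma abs_rpow_sub_le {s r x : ℝ} (hs : 0 < s) (hr : 0 ≤ r) (hx : x ∈ Icc (0 : ℝ) 1) :
    |x ^ (r + s) - x ^ s| ≤ r * (1 / s) := by
  rcases hx.1.eq_or_lt with rfl | h0
  · rw [Real.zero_rpow hs.ne', Real.zero_rpow (by positivity)]; simp; positivity
  · have hy : 0 ≤ -(r * Real.log x) := by nlinarith [Real.log_nonpos hx.1 hx.2]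
    have key : |x ^ r - 1| ≤ r * |Real.log x| := by
      rw [Real.rpow_def_of_pos h0, mul_comm (Real.log x),
        abs_of_nonpos (Real.log_nonpos hx.1 hx.2), abs_of_nonpos]
      · linarith [Real.add_one_le_exp (r * Real.log x)]
      · linarith [Real.exp_le_one_iff.2 (by linarith : r * Real.log x ≤ 0)]
    have e : x ^ (r + s) - x ^ s = x ^ s * (x ^ r - 1) := by rw [Real.rpow_add h0]; ring
    have h1 := abs_rpow_mul_log_le 1 hs hx
    simp only [pow_one, Nat.factorial_one, Nat.cast_one, abs_mul] at h1
    rw [e, abs_mul]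
    calc _ ≤ |x ^ s| * (r * |Real.log x|) := by gcongr
      _ = r * (|x ^ s| * |Real.log x|) := by ring
      _ ≤ _ := by gcongr

lemma norm_cfc_rpow_sub_le {s r : ℝ} (hs : 0 < s) (hr : 0 ≤ r) :
    ‖cfc (fun x : ℝ => x ^ (r + s)) (T 1) - cfc (fun x : ℝ => x ^ s) (T 1)‖ ≤ r * (1 / s) := by
  have hsa := h.selfAdjoint 1 one_pos
  have hc : ∀ u : ℝ, 0 < u → ContinuousOn (fun x : ℝ => x ^ u) (spectrum ℝ (T 1)) := by
    intro u hu
    simpa using (continuousOn_rpow_mul_log 0 hu).mono h.spectrum_subset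
  rw [← cfc_sub _ _ (T 1) (hc _ (by positivity)) (hc _ hs)]
  exact norm_cfc_le (by positivity) fun x hx => abs_rpow_sub_le hs hr (h.spectrum_subset hx)

lemma continuousAt_cfc_rpow {t : ℝ} (ht : 0 < t) :
    ContinuousAt (fun s : ℝ => cfc (fun x : ℝ => x ^ s) (T 1)) t := by
  have hb : ∀ᶠ s in 𝓝 t, ‖cfc (fun x : ℝ => x ^ s) (T 1) - cfc (fun x : ℝ => x ^ t) (T 1)‖ ≤
      |s - t| * (1 / (t / 2)) := by
    filter_upwards [lt_mem_nhds (half_lt_self ht)] with s hs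
    rcases le_total s t with hst | hst
    · have := h.norm_cfc_rpow_sub_le ((half_pos ht).trans hs) (sub_nonneg.2 hst)
      rw [sub_add_cancel] at this
      rw [norm_sub_rev, abs_sub_comm, abs_of_nonneg (sub_nonneg.2 hst)]
      refine this.trans ?_
      gcongr
    · have := h.norm_cfc_rpow_sub_le ht (sub_nonneg.2 hst)
      rw [sub_add_cancel] at this
      rw [abs_of_nonneg (sub_nonneg.2 hst)]
      refine this.trans ?_
      gcongr
      linarith
  rw [ContinuousAt, tendsto_iff_norm_sub_tendsto_zero]
  refine squeeze_zero' (Eventually.of_forall fun _ => norm_nonneg _) hb ?_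
  have : ContinuousAt (fun s : ℝ => |s - t| * (1 / (t / 2))) t := by fun_prop
  simpa using this.tendsto

/-- The form at time `u` is `‖T (u / 2) f‖²`, which a contraction decreases. This monotonicity
stands in for strong continuity, which is not assumed. -/
lemma inner_antitone (f : H) {s t : ℝ} (hs : 0 < s) (hst : s ≤ t) :
    (inner ℂ (T t f) f).re ≤ (inner ℂ (T s f) f).re := by
  have key : ∀ u, 0 < u → (inner ℂ (T u f) f).re = ‖T (u / 2) f‖ ^ 2 := by
    intro u hu
    have e : T u f = T (u / 2) (T (u / 2) f) := by
      rw [← mul_apply_eq_comp, ← h.add _ _ (half_pos hu) (half_pos hu), add_halves]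
    have := (h.selfAdjoint _ (half_pos hu)).isSymmetric (T (u / 2) f) f
    simp only [ContinuousLinearMap.coe_coe] at this
    rw [e, this, ← inner_self_eq_norm_sq (𝕜 := ℂ)]
    rfl
  rw [key _ hs, key _ (hs.trans_le hst)]
  rcases hst.eq_or_lt with rfl | hlt
  · rfl
  have : T (t / 2) f = T ((t - s) / 2) (T (s / 2) f) := by
    rw [← mul_apply_eq_comp, ← h.add _ _ (by linarith) (by linarith)]
    congr 2; ring
  rw [this]
  gcongr
  calc _ ≤ ‖T ((t - s) / 2)‖ * ‖T (s / 2) f‖ := ContinuousLinearMap.le_opNorm _ _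
    _ ≤ 1 * ‖T (s / 2) f‖ := by gcongr; exact h.norm_le _ (by linarith)
    _ = _ := one_mul _

/-- The two families agree at rational times. One has a monotone quadratic form and the other a
continuous one, so squeezing between rationals equates the forms, and a self-adjoint operator is
determined by its form. -/
lemma eq_cfc {t : ℝ} (ht : 0 < t) : T t = cfc (fun x : ℝ => x ^ t) (T 1) := by
  have h1 := h.nonneg one_pos
  set A : ℝ → H →L[ℂ] H := fun s => cfc (fun x : ℝ => x ^ s) (T 1) with hA
  have hrat : ∀ q : ℚ, 0 < q → T q = A q := by
    intro q hq
    obtain ⟨k, hk⟩ : ∃ k : ℕ, q.num = (k + 1 : ℕ) :=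
      ⟨(q.num - 1).toNat, by have := Rat.num_pos.2 hq; omega⟩
    obtain ⟨j, hj⟩ : ∃ j : ℕ, q.den = j + 1 := ⟨q.den - 1, by have := q.pos; omega⟩
    have e : (q : ℝ) = ((k + 1 : ℕ) : ℝ) / (j + 1 : ℕ) := by
      rw [Rat.cast_def, hk, hj]; push_cast; rfl
    simp only [hA]
    rw [e, h.rat_eq, CFC.rpow_eq_cfc_real]
  have hquad : ∀ f : H, (inner ℂ (T t f) f).re = (inner ℂ (A t f) f).re := by
    intro f
    have hc' : ContinuousAt (fun s => (inner ℂ (A s f) f).re) t := by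
      have e : Continuous fun B : H →L[ℂ] H => (inner ℂ (B f) f).re := by fun_prop
      exact e.continuousAt.comp (h.continuousAt_cfc_rpow ht)
    apply le_antisymm
    · by_contra! hlt
      obtain ⟨δ, hδ, hball⟩ := Metric.eventually_nhds_iff.1 (hc'.eventually (gt_mem_nhds hlt))
      obtain ⟨q, hq1, hq2⟩ := exists_rat_btwn (show max (t / 2) (t - δ) < t by
        rw [max_lt_iff]; constructor <;> linarith)
      have hq0 : (0 : ℝ) < q := by
        have := le_max_left (t / 2) (t - δ); linarith
      have h2 := hball (y := q) (by
        rw [Real.dist_eq, abs_lt]; have := le_max_right (t / 2) (t - δ); constructor <;> linarith)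
      have h3 := h.inner_antitone f hq0 hq2.le
      rw [hrat q (by exact_mod_cast hq0)] at h3
      linarith
    · by_contra! hlt
      obtain ⟨δ, hδ, hball⟩ := Metric.eventually_nhds_iff.1 (hc'.eventually (lt_mem_nhds hlt))
      obtain ⟨q, hq1, hq2⟩ := exists_rat_btwn (show t < t + δ by linarith)
      have h2 := hball (y := q) (by
        rw [Real.dist_eq, abs_lt]; constructor <;> linarith)
      have h3 := h.inner_antitone f ht hq1.le
      rw [hrat q (by exact_mod_cast ht.trans hq1)] at h3
      linarith
  have hsaA : IsSelfAdjoint (A t) := cfc_predicate _ _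
  have hsub : ((T t - A t : H →L[ℂ] H) : H →ₗ[ℂ] H) = 0 := by
    have hs := ((h.selfAdjoint t ht).sub hsaA).isSymmetric
    rw [← hs.inner_map_self_eq_zero]
    intro f
    have him := hs.im_inner_apply_self f
    have hre : (inner ℂ ((T t - A t) f) f).re = 0 := by
      simp [hquad f]
    apply Complex.ext
    · exact hre
    · exact him
  have : (T t - A t) = 0 := by
    ext f; exact LinearMap.congr_fun hsub f
  exact sub_eq_zero.1 this

/-- The operators `Aˡ e^{tA}` of a self-adjoint contraction semigroup `T t = e^{tA}`, their norm
bounds, and the first-order Taylor estimate in `t`. -/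
theorem exists_derivatives : ∃ D : ℕ → ℝ → H →L[ℂ] H,
    (∀ t, 0 < t → D 0 t = T t) ∧
    (∀ l r t, 0 < r → 0 < t → T r * D l t = D l (r + t)) ∧
    (∀ l t, 0 < t → ‖D l t‖ ≤ l.factorial / t ^ l) ∧
    (∀ l r t, 0 < r → 0 < t → ‖D l (r + t) - D l t - (r : ℂ) • D (l + 1) t‖ ≤
      r ^ 2 * ((l + 2).factorial / t ^ (l + 2))) := by
  have hsa := h.selfAdjoint 1 one_pos
  have hsp := h.spectrum_subset
  -- Formally `A = log (T 1)`, so `Aˡ e^{tA}` is a function of `T 1`, and each estimate becomes a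
  -- supremum over a spectrum contained in `[0, 1]`.
  refine ⟨fun l t => cfc (fun x : ℝ => x ^ t * Real.log x ^ l) (T 1), ?_, ?_, ?_, ?_⟩
  · intro t ht
    rw [h.eq_cfc ht]; simp
  · intro l r t hr ht
    have hc0 := (continuousOn_rpow_mul_log 0 hr).mono hsp
    simp only [pow_zero, mul_one] at hc0
    rw [h.eq_cfc hr, ← cfc_mul _ _ (T 1) hc0 ((continuousOn_rpow_mul_log l ht).mono hsp)]
    apply cfc_congr
    intro x hx
    have hx0 := (hsp hx).1
    simp only
    rw [Real.rpow_add_of_nonneg hx0 hr.le ht.le, mul_assoc]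
  · intro l t ht
    refine norm_cfc_le (by positivity) fun x hx => ?_
    exact abs_rpow_mul_log_le l ht (hsp hx)
  · intro l r t hr ht
    have e : cfc (fun x : ℝ => x ^ (r + t) * Real.log x ^ l) (T 1) -
        cfc (fun x : ℝ => x ^ t * Real.log x ^ l) (T 1) -
        (r : ℂ) • cfc (fun x : ℝ => x ^ t * Real.log x ^ (l + 1)) (T 1) =
        cfc (fun x : ℝ => x ^ (r + t) * Real.log x ^ l - x ^ t * Real.log x ^ l -
          r * (x ^ t * Real.log x ^ (l + 1))) (T 1) := by
      have c1 := (continuousOn_rpow_mul_log l (add_pos hr ht)).mono hsp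
      have c2 := (continuousOn_rpow_mul_log l ht).mono hsp
      have c3 := (continuousOn_rpow_mul_log (l + 1) ht).mono hsp
      rw [cfc_sub (fun x : ℝ => x ^ (r + t) * Real.log x ^ l - x ^ t * Real.log x ^ l)
        (fun x => r * (x ^ t * Real.log x ^ (l + 1))) (T 1) (c1.sub c2) (continuousOn_const.mul c3),
        cfc_sub _ _ (T 1) c1 c2, cfc_const_mul r _ (T 1) c3]
      congr 1
    simp only [e]
    refine norm_cfc_le (by positivity) fun x hx => ?_
    refine (abs_rpow_taylor_le l ht hr (hsp hx)).trans ?_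
    gcongr
    exact abs_rpow_mul_log_le (l + 2) ht (hsp hx)

end IsSelfAdjointSemigroup

end SelfAdjointSemigroup

/-! ### Symmetric sub-Markovian kernels and their `L²` operators -/

section HeatKernel

open ProbabilityTheory

variable {X : Type*} [MeasurableSpace X]

/-- A sub-Markovian semigroup of kernels, indexed by `t > 0`, that is symmetric with respect
to `m` and absolutely continuous. -/
structure IsHeatKernel (m : Measure X) (κ : ℝ → Kernel X X) : Prop where
  univ_le_one : ∀ t, 0 < t → ∀ x, κ t x univ ≤ 1
  ac : ∀ t, 0 < t → ∀ x, κ t x ≪ m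
  add : ∀ s t, 0 < s → 0 < t → κ (s + t) = κ t ∘ₖ κ s
  symm : ∀ t, 0 < t → (m ⊗ₘ κ t).map Prod.swap = m ⊗ₘ κ t

namespace IsHeatKernel

variable {m : Measure X} {κ : ℝ → Kernel X X} (h : IsHeatKernel m κ) {t : ℝ}
include h

lemma isFiniteKernel (ht : 0 < t) : IsFiniteKernel (κ t) :=
  ⟨⟨1, ENNReal.one_lt_top, h.univ_le_one t ht⟩⟩

/-- By symmetry the two marginals of `m ⊗ₘ κ t` coincide, and the first has density `κ t x univ ≤
1`. -/
lemma comp_le [SFinite m] (ht : 0 < t) : κ t ∘ₘ m ≤ m := by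
  have := h.isFiniteKernel ht
  rw [← Measure.snd_compProd, ← h.symm t ht, Measure.snd_map_swap]
  refine Measure.le_iff.2 fun s hs => ?_
  rw [Measure.fst_apply hs, show Prod.fst ⁻¹' s = s ×ˢ (univ : Set X) by ext; simp,
    Measure.compProd_apply_prod hs MeasurableSet.univ]
  calc _ ≤ ∫⁻ x in s, 1 ∂m := by
        gcongr with x; exact h.univ_le_one t ht x
    _ = m s := by simp

variable {E : Type*} [NormedAddCommGroup E]

lemma lintegral_lintegral_le [SFinite m] (ht : 0 < t) {f : X → ℝ≥0∞} (hf : AEMeasurable f m) :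
    ∫⁻ x, ∫⁻ y, f y ∂κ t x ∂m ≤ ∫⁻ x, f x ∂m := by
  rw [← Measure.lintegral_bind (κ t).measurable.aemeasurable (hf.mono_measure (h.comp_le ht))]
  exact lintegral_mono' (h.comp_le ht) le_rfl

lemma ae_memLp [SFinite m] (ht : 0 < t) {f : X → E} (hf : MemLp f 2 m) :
    ∀ᵐ x ∂m, MemLp f 2 (κ t x) := by
  have hm : AEMeasurable (fun x => ‖f x‖ₑ ^ 2) m := hf.1.enorm.pow_const 2
  have h1 := h.lintegral_lintegral_le ht hm
  have h2 : ∫⁻ x, ‖f x‖ₑ ^ 2 ∂m < ∞ := by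
    have := lintegral_rpow_enorm_lt_top_of_eLpNorm_lt_top (p := 2) (by simp) (by simp) hf.2
    simpa using this
  have h3 : AEMeasurable (fun x => ∫⁻ y, ‖f y‖ₑ ^ 2 ∂κ t x) m := by
    obtain ⟨g, hg, hfg⟩ := hm
    refine ⟨fun x => ∫⁻ y, g y ∂κ t x, hg.lintegral_kernel, Eventually.of_forall fun x => ?_⟩
    exact lintegral_congr_ae ((h.ac t ht x).ae_le hfg)
  filter_upwards [ae_lt_top' h3 (h1.trans_lt h2).ne] with x hx
  refine ⟨hf.1.mono_ac (h.ac t ht x), ?_⟩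
  rw [eLpNorm_lt_top_iff_lintegral_rpow_enorm_lt_top (by simp) (by simp)]
  simpa using hx

lemma memLp_integrable (ht : 0 < t) {f : X → E} {x : X} (hf : MemLp f 2 (κ t x)) :
    Integrable f (κ t x) := by
  have := h.isFiniteKernel ht
  exact hf.integrable (by norm_num)

variable [NormedSpace ℝ E]

/-- Jensen's inequality for the sub-probability measure `κ t x`. -/
lemma enorm_integral_sq_le (ht : 0 < t) {f : X → E} {x : X} (hf : AEStronglyMeasurable f m) :
    ‖∫ y, f y ∂κ t x‖ₑ ^ 2 ≤ ∫⁻ y, ‖f y‖ₑ ^ 2 ∂κ t x := by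
  have h1 : ‖∫ y, f y ∂κ t x‖ₑ ≤ eLpNorm f 1 (κ t x) := by
    rw [eLpNorm_one_eq_lintegral_enorm]
    exact enorm_integral_le_lintegral_enorm f
  have h2 : eLpNorm f 1 (κ t x) ≤ eLpNorm f 2 (κ t x) := by
    refine (eLpNorm_le_eLpNorm_mul_rpow_measure_univ (q := 2) (by norm_num)
      (hf.mono_ac (h.ac t ht x))).trans ?_
    calc _ ≤ eLpNorm f 2 (κ t x) * 1 := by
          gcongr
          refine ENNReal.rpow_le_one (h.univ_le_one t ht x) ?_
          norm_num
      _ = _ := mul_one _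
  have h3 : eLpNorm f 2 (κ t x) ^ 2 = ∫⁻ y, ‖f y‖ₑ ^ 2 ∂κ t x := by
    have := eLpNorm_nnreal_pow_eq_lintegral (p := 2) (f := f) (μ := κ t x) (by norm_num)
    simpa using this
  rw [← h3]
  gcongr
  exact h1.trans h2

lemma aestronglyMeasurable_integral (ht : 0 < t) {f : X → E} (hf : AEStronglyMeasurable f m) :
    AEStronglyMeasurable (fun x => ∫ y, f y ∂κ t x) m := by
  have := h.isFiniteKernel ht
  obtain ⟨g, hg, hfg⟩ := hf
  refine ⟨fun x => ∫ y, g y ∂κ t x, hg.integral_kernel, Eventually.of_forall fun x => ?_⟩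
  exact integral_congr_ae ((h.ac t ht x).ae_le hfg)

lemma eLpNorm_integral_le [SFinite m] (ht : 0 < t) {f : X → E} (hf : AEStronglyMeasurable f m) :
    eLpNorm (fun x => ∫ y, f y ∂κ t x) 2 m ≤ eLpNorm f 2 m := by
  have key : ∀ g : X → E, eLpNorm g 2 m ^ 2 = ∫⁻ y, ‖g y‖ₑ ^ 2 ∂m := by
    intro g
    have := eLpNorm_nnreal_pow_eq_lintegral (p := 2) (f := g) (μ := m) (by norm_num)
    simpa using this
  rw [← ENNReal.pow_le_pow_left_iff two_ne_zero, key, key]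
  exact (lintegral_mono fun x => h.enorm_integral_sq_le ht hf).trans
    (h.lintegral_lintegral_le ht (hf.enorm.pow_const 2))

lemma memLp_integral [SFinite m] (ht : 0 < t) {f : X → E} (hf : MemLp f 2 m) :
    MemLp (fun x => ∫ y, f y ∂κ t x) 2 m :=
  ⟨h.aestronglyMeasurable_integral ht hf.1, (h.eLpNorm_integral_le ht hf.1).trans_lt hf.2⟩

lemma integral_add_time {s : ℝ} (hs : 0 < s) (ht : 0 < t) {f : X → E} {x : X}
    (hf : Integrable f (κ (s + t) x)) :
    ∫ y, f y ∂κ (s + t) x = ∫ z, ∫ y, f y ∂κ t z ∂κ s x := by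
  have := h.isFiniteKernel hs
  have := h.isFiniteKernel ht
  rw [h.add s t hs ht] at hf ⊢
  exact Kernel.integral_comp hf

-- Absolute continuity gives this at every `x`, so kernels turn `L²` classes into functions defined
-- pointwise.
omit [NormedSpace ℝ E] in
lemma integral_congr' [NormedSpace ℝ E] (ht : 0 < t) {f g : X → E} (hfg : f =ᵐ[m] g) (x : X) :
    ∫ y, f y ∂κ t x = ∫ y, g y ∂κ t x :=
  integral_congr_ae ((h.ac t ht x).ae_le hfg)

end IsHeatKernel

variable {m : Measure X} [SFinite m] {κ : ℝ → Kernel X X}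

open Classical in
/-- The operator on `L²(m)` with kernel `κ t` (zero for `t ≤ 0`). -/
noncomputable def heatOp (h : IsHeatKernel m κ) (t : ℝ) : Lp ℂ 2 m →L[ℂ] Lp ℂ 2 m :=
  if ht : 0 < t then
    LinearMap.mkContinuous
      { toFun := fun f => (h.memLp_integral ht (Lp.memLp f)).toLp
        map_add' := fun f g => by
          apply Lp.ext
          refine (MemLp.coeFn_toLp _).trans ?_
          filter_upwards [Lp.coeFn_add (h.memLp_integral ht (Lp.memLp f)).toLp
            (h.memLp_integral ht (Lp.memLp g)).toLp,
            MemLp.coeFn_toLp (h.memLp_integral ht (Lp.memLp f)),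
            MemLp.coeFn_toLp (h.memLp_integral ht (Lp.memLp g)),
            h.ae_memLp ht (Lp.memLp f), h.ae_memLp ht (Lp.memLp g)] with x h1 h2 h3 h4 h5
          rw [h1, Pi.add_apply, h2, h3, h.integral_congr' ht (Lp.coeFn_add f g)]
          exact integral_add (h.memLp_integrable ht h4) (h.memLp_integrable ht h5)
        map_smul' := fun c f => by
          apply Lp.ext
          refine (MemLp.coeFn_toLp _).trans ?_
          filter_upwards [Lp.coeFn_smul c (h.memLp_integral ht (Lp.memLp f)).toLp,
            MemLp.coeFn_toLp (h.memLp_integral ht (Lp.memLp f))] with x h1 h2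
          rw [RingHom.id_apply, h1, Pi.smul_apply, h2, h.integral_congr' ht (Lp.coeFn_smul c f)]
          exact integral_smul c _ } 1 (fun f => by
        rw [one_mul]
        simp only [LinearMap.coe_mk, AddHom.coe_mk]
        rw [Lp.norm_toLp, Lp.norm_def]
        exact ENNReal.toReal_mono (Lp.eLpNorm_ne_top f) (h.eLpNorm_integral_le ht (Lp.memLp f).1))
  else 0

namespace IsHeatKernel

variable (h : IsHeatKernel m κ) {t : ℝ}

lemma heatOp_coe (ht : 0 < t) (f : Lp ℂ 2 m) :
    heatOp h t f =ᵐ[m] fun x => ∫ y, f y ∂κ t x := by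
  rw [heatOp, dif_pos ht]
  exact MemLp.coeFn_toLp (h.memLp_integral ht (Lp.memLp f))

lemma heatOp_norm_le (ht : 0 < t) : ‖heatOp h t‖ ≤ 1 := by
  rw [heatOp, dif_pos ht]
  exact LinearMap.mkContinuous_norm_le _ zero_le_one _

lemma heatOp_add {s : ℝ} (hs : 0 < s) (ht : 0 < t) :
    heatOp h (s + t) = heatOp h s * heatOp h t := by
  ext1 f
  apply Lp.ext
  refine (h.heatOp_coe (add_pos hs ht) f).trans ?_
  rw [mul_apply_eq_comp]
  refine EventuallyEq.trans ?_ (h.heatOp_coe hs _).symm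
  filter_upwards [h.ae_memLp (add_pos hs ht) (Lp.memLp f)] with x hx
  rw [h.integral_add_time hs ht (h.memLp_integrable (add_pos hs ht) hx)]
  exact (h.integral_congr' hs (h.heatOp_coe ht f) x).symm

include h in
lemma integrable_compProd (ht : 0 < t) {f g : X → ℂ} (hf : MemLp f 2 m)
    (hg : MemLp g 2 m) : Integrable (fun z : X × X => f z.1 * g z.2) (m ⊗ₘ κ t) := by
  have := h.isFiniteKernel ht
  have hfst : (m ⊗ₘ κ t).map Prod.fst ≤ m := by
    have h1 := h.comp_le ht
    rw [← Measure.snd_compProd, ← h.symm t ht, Measure.snd_map_swap] at h1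
    exact h1
  have hsnd : (m ⊗ₘ κ t).map Prod.snd ≤ m := by
    have h1 := h.comp_le ht
    rw [← Measure.snd_compProd] at h1
    exact h1
  have h1 : MemLp (fun z : X × X => f z.1) 2 (m ⊗ₘ κ t) :=
    (hf.mono_measure hfst).comp_of_map measurable_fst.aemeasurable
  have h2 : MemLp (fun z : X × X => g z.2) 2 (m ⊗ₘ κ t) :=
    (hg.mono_measure hsnd).comp_of_map measurable_snd.aemeasurable
  exact h1.integrable_mul h2

/-- In this form self-adjointness is the invariance of `m ⊗ₘ κ t` under swapping. -/
lemma inner_heatOp (ht : 0 < t) (f g : Lp ℂ 2 m) :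
    inner ℂ f (heatOp h t g) = ∫ z, star (f z.1) * g z.2 ∂(m ⊗ₘ κ t) := by
  have := h.isFiniteKernel ht
  have hi : Integrable (fun z : X × X => star (f z.1) * g z.2) (m ⊗ₘ κ t) :=
    h.integrable_compProd ht (Lp.memLp f).star (Lp.memLp g)
  rw [Measure.integral_compProd hi, L2.inner_def]
  apply integral_congr_ae
  filter_upwards [h.heatOp_coe ht g] with x hx
  rw [hx, RCLike.inner_apply, mul_comm, ← integral_const_mul]
  rfl

lemma heatOp_isSelfAdjoint (ht : 0 < t) : IsSelfAdjoint (heatOp h t) := by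
  rw [ContinuousLinearMap.isSelfAdjoint_iff_isSymmetric]
  intro f g
  simp only [ContinuousLinearMap.coe_coe]
  have hswap : ∀ F : X × X → ℂ, ∫ z, F z ∂(m ⊗ₘ κ t) = ∫ z, F z.swap ∂(m ⊗ₘ κ t) := by
    intro F
    conv_lhs => rw [← h.symm t ht]
    exact integral_map_equiv MeasurableEquiv.prodComm F
  rw [h.inner_heatOp ht, ← inner_conj_symm, h.inner_heatOp ht, hswap, ← integral_conj]
  congr 1
  ext z
  simp [mul_comm]

lemma isSelfAdjointSemigroup : IsSelfAdjointSemigroup (heatOp h) where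
  add _ _ hs ht := h.heatOp_add hs ht
  selfAdjoint _ ht := h.heatOp_isSelfAdjoint ht
  norm_le _ ht := h.heatOp_norm_le ht

end IsHeatKernel

end HeatKernel

/-! ### From `L²` to bounded continuous functions -/

section Ultracontractive

open ProbabilityTheory

variable {X : Type*} [MeasurableSpace X] [TopologicalSpace X]

/-- On-diagonal upper bounds of order `t ^ (-2ν)` and continuity in the starting point, for the
times `0 < t < T`. -/
structure IsUltracontractive (m : Measure X) (κ : ℝ → Kernel X X) (c ν : ℝ) (T : ℝ≥0∞) :
    Prop where
  le_smul : ∀ t, 0 < t → ENNReal.ofReal t < T → ∀ x,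
    κ t x ≤ ENNReal.ofReal (c ^ 2 / t ^ (2 * ν)) • m
  continuous_measure : ∀ t, 0 < t → ENNReal.ofReal t < T → ∀ s, MeasurableSet s → m s < ∞ →
    Continuous fun x => (κ t x).real s

variable {m : Measure X} {κ : ℝ → Kernel X X} {c ν : ℝ} {T : ℝ≥0∞} {t : ℝ}

namespace IsUltracontractive

variable {E : Type*} [NormedAddCommGroup E]

lemma memLp (hu : IsUltracontractive m κ c ν T) (ht : 0 < t) (htT : ENNReal.ofReal t < T)
    {f : X → E} (hf : MemLp f 2 m) (x : X) : MemLp f 2 (κ t x) :=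
  hf.of_measure_le_smul ENNReal.ofReal_ne_top (hu.le_smul t ht htT x)

variable [NormedSpace ℝ E]

/-- Jensen's inequality together with `κ t x ≤ c² t^(-2ν) m`. -/
lemma norm_integral_le (hu : IsUltracontractive m κ c ν T) (h : IsHeatKernel m κ) (hc : 0 ≤ c)
    (ht : 0 < t) (htT : ENNReal.ofReal t < T) {f : X → E} (hf : MemLp f 2 m) (x : X) :
    ‖∫ y, f y ∂κ t x‖ ≤ c / t ^ ν * (eLpNorm f 2 m).toReal := by
  have key : eLpNorm f 2 m ^ 2 = ∫⁻ y, ‖f y‖ₑ ^ 2 ∂m := by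
    have := eLpNorm_nnreal_pow_eq_lintegral (p := 2) (f := f) (μ := m) (by norm_num)
    simpa using this
  have h1 : ‖∫ y, f y ∂κ t x‖ₑ ^ 2 ≤ ENNReal.ofReal (c ^ 2 / t ^ (2 * ν)) * eLpNorm f 2 m ^ 2 := by
    refine (h.enorm_integral_sq_le ht hf.1).trans ?_
    rw [key, ← smul_eq_mul, ← lintegral_smul_measure]
    exact lintegral_mono' (hu.le_smul t ht htT x) le_rfl
  have h2 : ‖∫ y, f y ∂κ t x‖ ^ 2 ≤ (c / t ^ ν * (eLpNorm f 2 m).toReal) ^ 2 := by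
    have h3 := ENNReal.toReal_mono
      (ENNReal.mul_ne_top ENNReal.ofReal_ne_top (ENNReal.pow_ne_top hf.2.ne)) h1
    rw [ENNReal.toReal_mul, ENNReal.toReal_pow, ENNReal.toReal_pow, toReal_enorm,
      ENNReal.toReal_ofReal (by positivity)] at h3
    refine h3.trans_eq ?_
    rw [mul_pow, div_pow, mul_comm 2 ν, Real.rpow_mul ht.le]
    norm_cast
  exact (pow_le_pow_iff_left₀ (norm_nonneg _) (by positivity) two_ne_zero).1 h2

/-- True for indicators by hypothesis, hence for simple functions; by `norm_integral_le`, `L²`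
limits become uniform limits. -/
lemma continuous_integral (hu : IsUltracontractive m κ c ν T) (h : IsHeatKernel m κ) (hc : 0 ≤ c)
    (ht : 0 < t) (htT : ENNReal.ofReal t < T) (f : Lp ℂ 2 m) :
    Continuous fun x => ∫ y, f y ∂κ t x := by
  refine Lp.induction (p := 2) (by simp) (motive := fun f : Lp ℂ 2 m =>
    Continuous fun x => ∫ y, f y ∂κ t x) ?_ ?_ ?_ f
  · intro a s hs hms
    have : (fun x => ∫ y, (Lp.simpleFunc.indicatorConst 2 hs hms.ne a : Lp ℂ 2 m) y ∂κ t x) =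
        fun x => (κ t x).real s • a := by
      ext x
      rw [Lp.simpleFunc.coe_indicatorConst,
        h.integral_congr' ht (indicatorConstLp_coeFn (hs := hs) (hμs := hms.ne)),
        integral_indicator_const _ hs]
    rw [this]
    exact (hu.continuous_measure t ht htT s hs hms).smul continuous_const
  · intro f g hf hg _ hfc hgc
    have : (fun x => ∫ y, (hf.toLp f + hg.toLp g : Lp ℂ 2 m) y ∂κ t x) =
        fun x => ∫ y, hf.toLp f y ∂κ t x + ∫ y, hg.toLp g y ∂κ t x := by
      ext x
      rw [h.integral_congr' ht (Lp.coeFn_add _ _)]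
      exact integral_add (h.memLp_integrable ht (hu.memLp ht htT (Lp.memLp _) x))
        (h.memLp_integrable ht (hu.memLp ht htT (Lp.memLp _) x))
    rw [this]
    exact hfc.add hgc
  · rw [← isSeqClosed_iff_isClosed]
    intro F f hF hlim
    have hunif : TendstoUniformly (fun n x => ∫ y, F n y ∂κ t x) (fun x => ∫ y, f y ∂κ t x)
        atTop := by
      rw [Metric.tendstoUniformly_iff]
      intro ε hε
      have h1 : Tendsto (fun n => c / t ^ ν * ‖f - F n‖) atTop (𝓝 0) := by
        have := ((tendsto_const_nhds (x := f)).sub hlim).norm.const_mul (c / t ^ ν)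
        simpa using this
      filter_upwards [h1.eventually (gt_mem_nhds hε)] with n hn x
      have e : ∫ y, (f - F n : Lp ℂ 2 m) y ∂κ t x = ∫ y, f y ∂κ t x - ∫ y, F n y ∂κ t x := by
        rw [h.integral_congr' ht (Lp.coeFn_sub _ _)]
        exact integral_sub (h.memLp_integrable ht (hu.memLp ht htT (Lp.memLp _) x))
          (h.memLp_integrable ht (hu.memLp ht htT (Lp.memLp _) x))
      rw [dist_eq_norm, ← e]
      refine (hu.norm_integral_le h hc ht htT (Lp.memLp _) x).trans_lt ?_
      rwa [← Lp.norm_def]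
    exact hunif.continuous (Eventually.of_forall hF).frequently

end IsUltracontractive

variable [SFinite m] (h : IsHeatKernel m κ)

/-- The operators `Δˡ T_t` on `L²(m)`. -/
noncomputable def heatDeriv : ℕ → ℝ → Lp ℂ 2 m →L[ℂ] Lp ℂ 2 m :=
  Classical.choose h.isSelfAdjointSemigroup.exists_derivatives

/-- The function `Δˡ T_{τ + t} F`, defined pointwise, for `F ∈ L²(m)`. -/
noncomputable def smoothed (l : ℕ) (τ t : ℝ) (F : Lp ℂ 2 m) (x : X) : ℝ :=
  (∫ y, heatDeriv h l t F y ∂κ τ x).re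

namespace IsHeatKernel

omit [TopologicalSpace X] in
lemma heatDeriv_spec : (∀ t, 0 < t → heatDeriv h 0 t = heatOp h t) ∧
    (∀ l r t, 0 < r → 0 < t → heatOp h r * heatDeriv h l t = heatDeriv h l (r + t)) ∧
    (∀ l t, 0 < t → ‖heatDeriv h l t‖ ≤ l.factorial / t ^ l) ∧
    (∀ l r t, 0 < r → 0 < t →
      ‖heatDeriv h l (r + t) - heatDeriv h l t - (r : ℂ) • heatDeriv h (l + 1) t‖ ≤
      r ^ 2 * ((l + 2).factorial / t ^ (l + 2))) :=
  Classical.choose_spec h.isSelfAdjointSemigroup.exists_derivatives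

variable {τ : ℝ} (hu : IsUltracontractive m κ c ν T) (hc : 0 ≤ c) (hτ : 0 < τ)
  (hτT : ENNReal.ofReal τ < T)

include hu hc hτ hτT

lemma continuous_smoothed (l : ℕ) (t : ℝ) (F : Lp ℂ 2 m) : Continuous (smoothed h l τ t F) :=
  Complex.continuous_re.comp (hu.continuous_integral h hc hτ hτT _)

lemma abs_smoothed_le (l : ℕ) (ht : 0 < t) (F : Lp ℂ 2 m) (x : X) :
    |smoothed h l τ t F x| ≤ c / τ ^ ν * (l.factorial / t ^ l * ‖F‖) := by
  refine (Complex.abs_re_le_norm _).trans ?_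
  refine (hu.norm_integral_le h hc hτ hτT (Lp.memLp _) x).trans ?_
  rw [← Lp.norm_def]
  gcongr
  refine (ContinuousLinearMap.le_opNorm _ _).trans ?_
  gcongr
  exact h.heatDeriv_spec.2.2.1 l t ht

-- The kernels at times `r` and `τ` commute, so the flow for time `r` can be moved inside and
-- absorbed into the `L²` operator.
omit hc hτT in
lemma integral_smoothed (l : ℕ) (ht : 0 < t) {r : ℝ} (hr : 0 < r)
    (hrT : ENNReal.ofReal (r + τ) < T) (F : Lp ℂ 2 m) (x : X) :
    ∫ y, smoothed h l τ t F y ∂κ r x = (∫ y, heatDeriv h l (r + t) F y ∂κ τ x).re := by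
  have := h.isFiniteKernel hr
  have := h.isFiniteKernel hτ
  set G := heatDeriv h l t F
  have hi : Integrable G (κ (r + τ) x) :=
    h.memLp_integrable (add_pos hr hτ) (hu.memLp (add_pos hr hτ) hrT (Lp.memLp _) x)
  have hi' := hi
  rw [h.add r τ hr hτ] at hi'
  have e1 : ∫ y, smoothed h l τ t F y ∂κ r x = (∫ y, ∫ z, G z ∂κ τ y ∂κ r x).re :=
    integral_re hi'.integral_comp
  have e2 : heatDeriv h l (r + t) F = heatOp h r G := by
    rw [← h.heatDeriv_spec.2.1 l r t hr ht]; rfl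
  rw [e1, ← h.integral_add_time hr hτ hi, e2, h.integral_congr' hτ (h.heatOp_coe hr G),
    add_comm r τ, h.integral_add_time hτ hr (by rwa [add_comm])]

/-- The `L² → L^∞` bound applied to the operator Taylor remainder; this makes the estimate uniform
in `x`. -/
lemma abs_integral_smoothed_sub_le (l : ℕ) (ht : 0 < t) {r : ℝ} (hr : 0 < r)
    (hrT : ENNReal.ofReal (r + τ) < T) (F : Lp ℂ 2 m) (x : X) :
    |∫ y, smoothed h l τ t F y ∂κ r x - smoothed h l τ t F x - r * smoothed h (l + 1) τ t F x| ≤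
      r ^ 2 * (c / τ ^ ν * ((l + 2).factorial / t ^ (l + 2) * ‖F‖)) := by
  rw [h.integral_smoothed hu hτ l ht hr hrT]
  have hi : ∀ G : Lp ℂ 2 m, Integrable G (κ τ x) := fun G =>
    h.memLp_integrable hτ (hu.memLp hτ hτT (Lp.memLp G) x)
  let G := (heatDeriv h l (r + t) - heatDeriv h l t - (r : ℂ) • heatDeriv h (l + 1) t) F
  have e : ∫ y, G y ∂κ τ x = ∫ y, heatDeriv h l (r + t) F y ∂κ τ x -
      ∫ y, heatDeriv h l t F y ∂κ τ x - r * ∫ y, heatDeriv h (l + 1) t F y ∂κ τ x := by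
    have e1 : G =ᵐ[m] fun y => heatDeriv h l (r + t) F y - heatDeriv h l t F y -
        r * heatDeriv h (l + 1) t F y := by
      have e0 : G = heatDeriv h l (r + t) F - heatDeriv h l t F -
        (r : ℂ) • heatDeriv h (l + 1) t F := rfl
      rw [e0]
      filter_upwards [Lp.coeFn_sub (heatDeriv h l (r + t) F - heatDeriv h l t F)
        ((r : ℂ) • heatDeriv h (l + 1) t F), Lp.coeFn_sub (heatDeriv h l (r + t) F)
        (heatDeriv h l t F), Lp.coeFn_smul (r : ℂ) (heatDeriv h (l + 1) t F)] with y h1 h2 h3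
      rw [h1, Pi.sub_apply, h2, Pi.sub_apply, h3, Pi.smul_apply, smul_eq_mul]
    rw [h.integral_congr' hτ e1, ← integral_const_mul, ← integral_sub (hi _) (hi _)]
    exact integral_sub ((hi _).sub (hi _)) ((hi _).const_mul _)
  have e2 : (∫ y, heatDeriv h l (r + t) F y ∂κ τ x).re - smoothed h l τ t F x -
      r * smoothed h (l + 1) τ t F x = (∫ y, G y ∂κ τ x).re := by
    rw [e]; simp [smoothed]
  rw [e2]
  refine (Complex.abs_re_le_norm _).trans ?_
  refine (hu.norm_integral_le h hc hτ hτT (Lp.memLp _) x).trans ?_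
  rw [← Lp.norm_def, mul_left_comm, ← mul_assoc (r ^ 2)]
  gcongr
  refine (ContinuousLinearMap.le_opNorm _ _).trans ?_
  gcongr
  exact h.heatDeriv_spec.2.2.2 l r t hr ht

omit [TopologicalSpace X] hu hc hτT in
lemma smoothed_zero (ht : 0 < t) {φ : X → ℝ} (hφ : MemLp (fun x => (φ x : ℂ)) 2 m) (x : X)
    (hi : Integrable φ (κ (τ + t) x)) :
    smoothed h 0 τ t hφ.toLp x = ∫ y, φ y ∂κ (τ + t) x := by
  rw [smoothed, h.heatDeriv_spec.1 t ht, h.integral_congr' hτ (h.heatOp_coe ht _)]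
  simp_rw [h.integral_congr' ht hφ.coeFn_toLp]
  rw [← h.integral_add_time hτ ht hi.ofReal, integral_complex_ofReal, Complex.ofReal_re]

end IsHeatKernel

end Ultracontractive

/-! ### Families of iterated generators -/

section SmoothFamily

open ProbabilityTheory

variable {X : Type*} [MeasurableSpace X] [TopologicalSpace X]

/-- A sequence `U 0, U 1, …` of bounded continuous functions such that `U (l + 1)` is the time
derivative at `0` of the semigroup applied to `U l`, with a uniform second-order error bound. -/
structure IsSmoothFamily (κ : ℝ → Kernel X X) (U : ℕ → X → ℝ) (b : ℕ → ℝ) (R : ℝ) : Prop where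
  continuous : ∀ l, Continuous (U l)
  abs_le : ∀ l x, |U l x| ≤ b l
  taylor : ∀ l r, 0 < r → r < R → ∀ x,
    |∫ y, U l y ∂κ r x - U l x - r * U (l + 1) x| ≤ r ^ 2 * b (l + 2)

namespace IsSmoothFamily

variable {κ : ℝ → Kernel X X} {R : ℝ}

/-- Every clause is an estimate with summable constants, and summability also allows the series to
be integrated term by term. -/
lemma tsum [OpensMeasurableSpace X] (hκ : ∀ t, 0 < t → IsFiniteKernel (κ t)) {u : ℕ → ℕ → X → ℝ}
    {b : ℕ → ℕ → ℝ}
    (hu : ∀ j, IsSmoothFamily κ (u j) (b j) R) (hb : ∀ l, Summable fun j => b j l) :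
    IsSmoothFamily κ (fun l x => ∑' j, u j l x) (fun l => ∑' j, b j l) R where
  continuous l := continuous_tsum (fun j => (hu j).continuous l) (hb l) fun j x => (hu j).abs_le l x
  abs_le l x := by
    rw [← Real.norm_eq_abs]
    exact tsum_of_norm_bounded (hb l).hasSum fun j => (hu j).abs_le l x
  taylor l r hr hrR x := by
    have := hκ r hr
    have hs : ∀ l y, Summable fun j => u j l y := fun l y =>
      Summable.of_norm_bounded (hb l) fun j => (hu j).abs_le l y
    have hint : ∀ j, Integrable (u j l) (κ r x) := fun j =>
      Integrable.of_bound ((hu j).continuous l).measurable.aestronglyMeasurable (b j l)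
        (Eventually.of_forall fun y => (hu j).abs_le l y)
    have hsum : Summable fun j => ∫ y, ‖u j l y‖ ∂κ r x := by
      refine Summable.of_nonneg_of_le (fun j => integral_nonneg fun y => norm_nonneg _)
        (fun j => ?_) ((hb l).mul_right ((κ r x).real univ))
      refine (integral_mono (hint j).norm (integrable_const (b j l))
        fun y => (hu j).abs_le l y).trans_eq ?_
      simp [mul_comm]
    have h1 : HasSum (fun j => ∫ y, u j l y ∂κ r x) (∫ y, ∑' j, u j l y ∂κ r x) :=
      hasSum_integral_of_summable_integral_norm hint hsum
    have h2 := (h1.sub (hs l x).hasSum).sub ((hs (l + 1) x).hasSum.mul_left r)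
    rw [← h2.tsum_eq]
    rw [← Real.norm_eq_abs]
    exact tsum_of_norm_bounded ((hb (l + 2)).hasSum.mul_left (r ^ 2))
      fun j => by rw [Real.norm_eq_abs]; exact (hu j).taylor l r hr hrR x

/-- Dividing the Taylor bound by `t` leaves an error of at most `t * b (l + 2)`, uniformly in `x`.
-/
lemma hasGeneratorPow [OpensMeasurableSpace X] {U : ℕ → X → ℝ} {b : ℕ → ℝ} (hR : 0 < R)
    (hU : IsSmoothFamily κ U b R)
    {Ω : Type*} [MeasurableSpace Ω] (Z : Diffusion X Ω)
    (hZ : ∀ (t : ℝ≥0) (f : X → ℝ), 0 < t → Measurable f → ∀ x,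
      Z.semigroup t f x = ∫ y, f y ∂κ t x)
    (F : ℕ → C₀(X, ℝ)) (hF : ∀ l x, F l x = U l x) (l : ℕ) : Z.HasGeneratorPow l (F 0) (F l) := by
  induction l with
  | zero => rfl
  | succ l ih =>
    refine ⟨F l, ih, ?_⟩
    rw [Diffusion.HasGenerator, Metric.tendstoUniformly_iff]
    intro ε hε
    have hlim : Tendsto (fun t : ℝ≥0 => (t : ℝ) * b (l + 2)) (𝓝[>] 0) (𝓝 0) := by
      have : Continuous fun t : ℝ≥0 => (t : ℝ) * b (l + 2) := by fun_prop
      have := this.tendsto 0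
      simp only [NNReal.coe_zero, zero_mul] at this
      exact this.mono_left nhdsWithin_le_nhds
    have hR' : ∀ᶠ t : ℝ≥0 in 𝓝[>] 0, (t : ℝ) < R := by
      have : Continuous fun t : ℝ≥0 => (t : ℝ) := by fun_prop
      exact nhdsWithin_le_nhds ((this.tendsto 0).eventually (gt_mem_nhds (by simpa using hR)))
    filter_upwards [self_mem_nhdsWithin, hlim.eventually (gt_mem_nhds hε), hR'] with t ht hlt htR x
    have ht0 : (0 : ℝ) < t := ht
    have h1 := hU.taylor l t ht0 htR x
    have e : ⇑(F l) = U l := funext (hF l)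
    rw [dist_comm, Real.dist_eq, hZ t _ ht (by rw [e]; exact (hU.continuous l).measurable) x, e, hF]
    have e2 : (∫ y, U l y ∂κ t x - U l x) / (t : ℝ) - U (l + 1) x =
        (∫ y, U l y ∂κ t x - U l x - t * U (l + 1) x) / t := by
      field_simp
    rw [e2, abs_div, abs_of_pos ht0, div_lt_iff₀ ht0]
    nlinarith

end IsSmoothFamily

end SmoothFamily

/-! ### Tail bounds and locality of the generator -/

section Tails

open ProbabilityTheory

variable {X : Type*} [MeasurableSpace X] [MetricSpace X] [OpensMeasurableSpace X]

/-- Polynomial bounds of every order for the probability of leaving the ball of radius `δ` before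
time `t`, for the times `0 < t < T`. -/
def HasTailBounds (κ : ℝ → Kernel X X) (dw : ℝ) (a : ℝ → ℝ) (T : ℝ≥0∞) : Prop :=
  ∀ N, 0 < N → ∀ t, 0 < t → ENNReal.ofReal t < T → ∀ δ, 0 < δ → ∀ x,
    (κ t x).real {y | δ ≤ dist x y} ≤ a N * (t / δ ^ dw) ^ N

lemma abs_integral_le_mul_measureReal {μ : Measure X} [IsFiniteMeasure μ] {f : X → ℝ} {M δ : ℝ}
    {x : X}
    (hM : ∀ y, |f y| ≤ M) (hf : ∀ y, dist x y < δ → f y = 0) :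
    |∫ y, f y ∂μ| ≤ M * μ.real {y | δ ≤ dist x y} := by
  have hs : MeasurableSet {y | δ ≤ dist x y} :=
    (isClosed_le continuous_const (continuous_const.dist continuous_id)).measurableSet
  have e : ∫ y, f y ∂μ = ∫ y in {y | δ ≤ dist x y}, f y ∂μ := by
    rw [← integral_indicator hs]
    congr 1
    ext y
    by_cases hy : y ∈ {y | δ ≤ dist x y}
    · rw [indicator_of_mem hy]
    · rw [indicator_of_notMem hy, hf y (not_le.1 hy)]
  rw [e, ← Real.norm_eq_abs]
  exact norm_setIntegral_le_of_norm_le_const (measure_lt_top _ _) fun y _ => (Real.norm_eq_abs _).trans_le (hM y)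

/-- If `U l` vanishes near `x`, its evolution at `x` only sees mass that has left a ball, which is
`O(r²)`; so the first-order term `r * U (l + 1) x` is `O(r²)` as well. -/
lemma IsSmoothFamily.eq_zero_of_infDist {κ : ℝ → Kernel X X} (hκ : ∀ t, 0 < t → IsFiniteKernel (κ t))
    {dw : ℝ} {a : ℝ → ℝ} {T : ℝ≥0∞} (hT : 0 < T) (ha : HasTailBounds κ dw a T)
    {U : ℕ → X → ℝ} {b : ℕ → ℝ} {R : ℝ} (hR : 0 < R) (hU : IsSmoothFamily κ U b R)
    {V : Set X} (hV : IsOpen V) (h0 : ∀ x ∈ V, U 0 x = 0) (l : ℕ) : ∀ x ∈ V, U l x = 0 := by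
  induction l with
  | zero => exact h0
  | succ l ih =>
    intro x hx
    obtain ⟨δ, hδ, hball⟩ := Metric.isOpen_iff.1 hV x hx
    have hb : ∀ l, 0 ≤ b l := fun l => (abs_nonneg _).trans (hU.abs_le l x)
    have key : ∀ᶠ r : ℝ in 𝓝[>] 0, |U (l + 1) x| ≤
        r * (b (l + 2) + b l * (a 2 * (1 / δ ^ dw) ^ (2 : ℝ))) := by
      have hT' : ∀ᶠ r : ℝ in 𝓝[>] 0, ENNReal.ofReal r < T := by
        have := (ENNReal.continuous_ofReal.tendsto 0).eventually
          (gt_mem_nhds (by simpa using hT))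
        exact nhdsWithin_le_nhds this
      filter_upwards [self_mem_nhdsWithin, hT', nhdsWithin_le_nhds (gt_mem_nhds hR)]
        with r hr hrT hrR
      have hr0 : 0 < r := hr
      have := hκ r hr0
      have h1 := hU.taylor l r hr0 hrR x
      -- Order `2` is enough: after division by `r` the tail still tends to `0`.
      have h2 : |∫ y, U l y ∂κ r x| ≤ b l * (a 2 * (r / δ ^ dw) ^ (2 : ℝ)) := by
        refine (abs_integral_le_mul_measureReal (δ := δ) (x := x) (hU.abs_le l) fun y hy =>
          ih y (hball (by rwa [Metric.mem_ball, dist_comm]))).trans ?_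
        gcongr
        · exact hb l
        · exact ha 2 two_pos r hr0 hrT δ hδ x
      rw [ih x hx, sub_zero] at h1
      have h3 : |r * U (l + 1) x| ≤ r ^ 2 * b (l + 2) + b l * (a 2 * (r / δ ^ dw) ^ (2 : ℝ)) := by
        have := abs_sub_abs_le_abs_sub (r * U (l + 1) x) (∫ y, U l y ∂κ r x)
        rw [abs_sub_comm] at this
        linarith
      rw [abs_mul, abs_of_pos hr0] at h3
      have e : (r / δ ^ dw) ^ (2 : ℝ) = r ^ 2 * (1 / δ ^ dw) ^ (2 : ℝ) := by
        rw [Real.rpow_two, Real.rpow_two]; ring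
      rw [e] at h3
      refine le_of_mul_le_mul_left (h3.trans_eq ?_) hr0
      ring
    have hlim : Tendsto (fun r : ℝ => r * (b (l + 2) + b l * (a 2 * (1 / δ ^ dw) ^ (2 : ℝ))))
        (𝓝[>] 0) (𝓝 0) := by
      have : Continuous fun r : ℝ => r * (b (l + 2) + b l * (a 2 * (1 / δ ^ dw) ^ (2 : ℝ))) := by
        fun_prop
      have := this.tendsto 0
      rw [zero_mul] at this
      exact this.mono_left nhdsWithin_le_nhds
    exact abs_nonpos_iff.1 (ge_of_tendsto hlim key)

end Tails

/-! ### Successive cut-offs: size, telescoping, `L²` norm -/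

section Cutoff

open ProbabilityTheory

variable {X : Type*} [MeasurableSpace X]

open Classical in
/-- Successive cut-offs: starting from `H 0`, set to `0` on `O 0`, the function is repeatedly
evolved by `κ (r k)`, and reset to `H (k + 1)` on `I (k + 1)` and to `0` on `O (k + 1)`. -/
noncomputable def cutoff (κ : ℝ → Kernel X X) (r : ℕ → ℝ) (I O : ℕ → Set X) (H : ℕ → X → ℝ) :
    ℕ → X → ℝ
  | 0 => (O 0)ᶜ.indicator (H 0)
  | k + 1 => (O (k + 1))ᶜ.indicator
      ((I (k + 1)).piecewise (H (k + 1)) fun x => ∫ y, cutoff κ r I O H k y ∂κ (r k) x)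

/-- The difference between a cut-off and the evolution of the preceding one. -/
noncomputable def cutoffError (κ : ℝ → Kernel X X) (r : ℕ → ℝ) (I O : ℕ → Set X)
    (H : ℕ → X → ℝ) : ℕ → X → ℝ
  | 0 => cutoff κ r I O H 0
  | k + 1 => fun x => cutoff κ r I O H (k + 1) x - ∫ y, cutoff κ r I O H k y ∂κ (r k) x

/-- The data of a sequence of cut-offs of the solution `H k = T_{s - t k} g` of the heat equation,
at decreasing times `t k`. -/
structure CutoffData (κ : ℝ → Kernel X X) (t : ℕ → ℝ) (I O : ℕ → Set X) (H : ℕ → X → ℝ)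
    (M : ℝ) : Prop where
  pos : ∀ k, 0 < t k
  lt : ∀ k, t (k + 1) < t k
  measurableSet_inner : ∀ k, MeasurableSet (I k)
  measurableSet_outer : ∀ k, MeasurableSet (O k)
  disjoint : ∀ k, Disjoint (I k) (O k)
  measurable : ∀ k, Measurable (H k)
  abs_le : ∀ k x, |H k x| ≤ M
  step : ∀ k x, H (k + 1) x = ∫ y, H k y ∂κ (t k - t (k + 1)) x

namespace CutoffData

variable {m : Measure X} {κ : ℝ → Kernel X X} (h : IsHeatKernel m κ) {t : ℕ → ℝ} {I O : ℕ → Set X}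
  {H : ℕ → X → ℝ} {M : ℝ} (c : CutoffData κ t I O H M)

local notation "φ" => cutoff κ (fun k => t k - t (k + 1)) I O H
local notation "ψ" => cutoffError κ (fun k => t k - t (k + 1)) I O H

include c

lemma step_pos (k : ℕ) : 0 < t k - t (k + 1) := sub_pos.2 (c.lt k)

omit c in
lemma cutoff_outer (k : ℕ) {x : X} (hx : x ∈ O k) : φ k x = 0 := by
  cases k <;> exact indicator_of_notMem (fun hx' : x ∈ (O _)ᶜ => hx' hx) _

lemma cutoff_inner (k : ℕ) {x : X} (hx : x ∈ I k) : φ k x = H k x := by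
  have hx' : x ∈ (O k)ᶜ := disjoint_left.1 (c.disjoint k) hx
  cases k with
  | zero => exact indicator_of_mem hx' _
  | succ k => classical rw [cutoff, indicator_of_mem hx', piecewise_eq_of_mem _ _ _ hx]

include h

omit c in
lemma abs_integral_le {s : ℝ} (hs : 0 < s) {f : X → ℝ} (hM : ∀ x, |f x| ≤ M) (x : X) :
    |∫ y, f y ∂κ s x| ≤ M := by
  have := h.isFiniteKernel hs
  have hM0 : 0 ≤ M := (abs_nonneg _).trans (hM x)
  rw [← Real.norm_eq_abs]
  refine (norm_integral_le_of_norm_le_const (C := M) (Eventually.of_forall hM)).trans ?_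
  refine mul_le_of_le_one_right hM0 ?_
  exact ENNReal.toReal_le_of_le_ofReal zero_le_one (by simpa using h.univ_le_one s hs x)

lemma measurable_cutoff (k : ℕ) : Measurable (φ k) := by
  induction k with
  | zero => exact (c.measurable 0).indicator (c.measurableSet_outer 0).compl
  | succ k ih =>
    have := h.isFiniteKernel (c.step_pos k)
    refine Measurable.indicator ?_ (c.measurableSet_outer _).compl
    exact Measurable.piecewise (c.measurableSet_inner _) (c.measurable _)
      ih.stronglyMeasurable.integral_kernel.measurable

lemma abs_cutoff_le (k : ℕ) (x : X) : |φ k x| ≤ M := by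
  have hM0 : 0 ≤ M := (abs_nonneg _).trans (c.abs_le 0 x)
  induction k generalizing x with
  | zero =>
    rw [cutoff, indicator]
    split_ifs
    · exact c.abs_le _ _
    · simpa
  | succ k ih =>
    rw [cutoff, indicator]
    split_ifs
    · rw [piecewise]
      split_ifs
      · exact c.abs_le _ _
      · exact abs_integral_le h (c.step_pos k) (fun y => ih y) x
    · simpa

omit h c in
lemma cutoff_nonneg (hH : ∀ k x, 0 ≤ H k x) (k : ℕ) (x : X) : 0 ≤ φ k x := by
  induction k generalizing x with
  | zero => exact indicator_nonneg (fun y _ => hH 0 y) x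
  | succ k ih =>
    refine indicator_nonneg (fun y _ => ?_) x
    rw [piecewise]
    split_ifs
    · exact hH _ _
    · exact integral_nonneg ih

lemma measurable_cutoffError (k : ℕ) : Measurable (ψ k) := by
  cases k with
  | zero => exact c.measurable_cutoff h 0
  | succ k =>
    have := h.isFiniteKernel (c.step_pos k)
    exact (c.measurable_cutoff h (k + 1)).sub
      (c.measurable_cutoff h k).stronglyMeasurable.integral_kernel.measurable

omit c in
lemma integrable_of_bounded {s : ℝ} (hs : 0 < s) {f : X → ℝ} (hf : Measurable f) {B : ℝ}
    (hB : ∀ x, |f x| ≤ B) (x : X) : Integrable f (κ s x) := by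
  have := h.isFiniteKernel hs
  exact Integrable.of_bound hf.aestronglyMeasurable B (Eventually.of_forall hB)

lemma abs_cutoffError_le_two (k : ℕ) (x : X) : |ψ k x| ≤ 2 * M := by
  have hM0 : 0 ≤ M := (abs_nonneg _).trans (c.abs_le 0 x)
  cases k with
  | zero => exact (c.abs_cutoff_le h 0 x).trans (by linarith)
  | succ k =>
    refine (abs_sub _ _).trans ?_
    have h1 := c.abs_cutoff_le h (k + 1) x
    have h2 := abs_integral_le h (c.step_pos k) (c.abs_cutoff_le h k) x
    linarith

/-- Telescoping: by Chapman–Kolmogorov, evolving `ψ (k + 1)` for time `t (k + 1)` gives the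
difference of the evolved `φ (k + 1)` and `φ k`. -/
lemma sum_integral_cutoffError (k : ℕ) (x : X) :
    ∑ j ∈ Finset.range (k + 1), ∫ y, ψ j y ∂κ (t j) x = ∫ y, φ k y ∂κ (t k) x := by
  induction k with
  | zero => simp [cutoffError]
  | succ k ih =>
    have hi : Integrable (φ k) (κ (t (k + 1) + (t k - t (k + 1))) x) :=
      integrable_of_bounded h (by rw [add_sub_cancel]; exact c.pos k)
        (c.measurable_cutoff h k) (c.abs_cutoff_le h k) x
    have e := h.integral_add_time (c.pos (k + 1)) (c.step_pos k) hi
    rw [add_sub_cancel] at e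
    have := h.isFiniteKernel (c.step_pos k)
    rw [Finset.sum_range_succ, ih, e]
    simp only [cutoffError]
    rw [integral_sub (integrable_of_bounded h (c.pos _) (c.measurable_cutoff h _)
      (c.abs_cutoff_le h _) x)
      (integrable_of_bounded h (c.pos _)
        (c.measurable_cutoff h k).stronglyMeasurable.integral_kernel.measurable
        (fun z => abs_integral_le h (c.step_pos k) (c.abs_cutoff_le h k) z) x)]
    ring

lemma lintegral_cutoff_le {W : Set X} (hWm : MeasurableSet W) (hW : ∀ k, (O k)ᶜ ⊆ W) (k : ℕ) :
    ∫⁻ x, ‖φ k x‖ₑ ∂m ≤ ENNReal.ofReal M * m W := by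
  rw [← lintegral_indicator_const hWm]
  refine lintegral_mono fun x => ?_
  by_cases hx : x ∈ W
  · rw [indicator_of_mem hx, Real.enorm_eq_ofReal_abs]
    exact ENNReal.ofReal_le_ofReal (c.abs_cutoff_le h k x)
  · rw [cutoff_outer k (not_not.1 fun hx' => hx (hW k hx'))]
    simp

lemma lintegral_cutoffError_le [SFinite m] {W : Set X} (hWm : MeasurableSet W)
    (hW : ∀ k, (O k)ᶜ ⊆ W) (k : ℕ) :
    ∫⁻ x, ‖ψ k x‖ₑ ∂m ≤ 2 * (ENNReal.ofReal M * m W) := by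
  cases k with
  | zero =>
    refine (c.lintegral_cutoff_le h hWm hW 0).trans ?_
    exact le_mul_of_one_le_left' one_le_two
  | succ k =>
    calc _ ≤ ∫⁻ x, (‖φ (k + 1) x‖ₑ + ∫⁻ y, ‖φ k y‖ₑ ∂κ (t k - t (k + 1)) x) ∂m := by
          refine lintegral_mono fun x => (enorm_sub_le).trans ?_
          gcongr
          exact enorm_integral_le_lintegral_enorm _
      _ = ∫⁻ x, ‖φ (k + 1) x‖ₑ ∂m + ∫⁻ x, ∫⁻ y, ‖φ k y‖ₑ ∂κ (t k - t (k + 1)) x ∂m :=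
          lintegral_add_left (c.measurable_cutoff h (k + 1)).enorm _
      _ ≤ ENNReal.ofReal M * m W + ENNReal.ofReal M * m W := by
          gcongr
          · exact c.lintegral_cutoff_le h hWm hW _
          · exact (h.lintegral_lintegral_le (c.step_pos k)
              (c.measurable_cutoff h k).enorm.aemeasurable).trans
              (c.lintegral_cutoff_le h hWm hW _)
      _ = _ := by ring

/-- Interpolation `‖ψ‖₂² ≤ ‖ψ‖_∞ ‖ψ‖₁`. The jump need not be supported in `W`, but its `L¹` norm is
controlled by `m W` because the flow contracts `L¹`. -/
lemma eLpNorm_cutoffError_le [SFinite m] {W : Set X} (hWm : MeasurableSet W)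
    (hW : ∀ k, (O k)ᶜ ⊆ W) (hWfin : m W < ∞) (hM : 0 ≤ M) {k : ℕ} {η : ℝ} (hη : 0 ≤ η)
    (hψ : ∀ x, |ψ k x| ≤ 2 * M * η) :
    eLpNorm (fun x => (ψ k x : ℂ)) 2 m ≤ ENNReal.ofReal (2 * M * √(η * (m W).toReal)) := by
  have key : eLpNorm (fun x => (ψ k x : ℂ)) 2 m ^ 2 = ∫⁻ y, ‖(ψ k y : ℂ)‖ₑ ^ 2 ∂m := by
    have := eLpNorm_nnreal_pow_eq_lintegral (p := 2) (f := fun x => (ψ k x : ℂ)) (μ := m)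
      (by norm_num)
    simpa using this
  rw [← ENNReal.pow_le_pow_left_iff two_ne_zero, key]
  calc ∫⁻ y, ‖(ψ k y : ℂ)‖ₑ ^ 2 ∂m ≤ ∫⁻ y, ENNReal.ofReal (2 * M * η) * ‖ψ k y‖ₑ ∂m := by
        refine lintegral_mono fun y => ?_
        have : ‖(ψ k y : ℂ)‖ₑ = ‖ψ k y‖ₑ := by
          rw [← ofReal_norm, ← ofReal_norm, Complex.norm_real]
        rw [this, sq]
        gcongr
        rw [Real.enorm_eq_ofReal_abs]
        exact ENNReal.ofReal_le_ofReal (hψ y)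
    _ = ENNReal.ofReal (2 * M * η) * ∫⁻ y, ‖ψ k y‖ₑ ∂m :=
        lintegral_const_mul _ (c.measurable_cutoffError h k).enorm
    _ ≤ ENNReal.ofReal (2 * M * η) * (2 * (ENNReal.ofReal M * m W)) := by
        gcongr
        exact c.lintegral_cutoffError_le h hWm hW k
    _ = ENNReal.ofReal (2 * M * √(η * (m W).toReal)) ^ 2 := by
        rw [← ENNReal.ofReal_pow (by positivity), mul_pow, Real.sq_sqrt (by positivity)]
        conv_lhs => rw [← ENNReal.ofReal_toReal hWfin.ne, ← ENNReal.ofReal_mul hM,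
          show (2 : ℝ≥0∞) = ENNReal.ofReal 2 by simp, ← ENNReal.ofReal_mul zero_le_two,
          ← ENNReal.ofReal_mul (by positivity)]
        congr 1; ring

end CutoffData

end Cutoff

/-! ### Smallness of the jumps -/

section CutoffMetric

open ProbabilityTheory

namespace CutoffData

variable {X : Type*} [MeasurableSpace X] [MetricSpace X] [OpensMeasurableSpace X]
  {m : Measure X} {κ : ℝ → Kernel X X} (h : IsHeatKernel m κ) {t : ℕ → ℝ} {I O : ℕ → Set X}
  {H : ℕ → X → ℝ} {M : ℝ} (c : CutoffData κ t I O H M)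

local notation "φ" => cutoff κ (fun k => t k - t (k + 1)) I O H
local notation "ψ" => cutoffError κ (fun k => t k - t (k + 1)) I O H

include h c

/-- Off the resetting regions the jump is zero by construction. On them the reset agrees with the
flow up to mass travelling further than `δ`: on `O (k + 1)` because `φ k` vanishes nearby, on `I (k
+ 1)` because `φ k = H k` nearby and `H (k + 1)` is the evolution of `H k`. -/
lemma abs_cutoffError_succ_le {k : ℕ} {δ η : ℝ}
    (hI : ∀ x ∈ I (k + 1), ∀ y, dist x y < δ → y ∈ I k)
    (hO : ∀ x ∈ O (k + 1), ∀ y, dist x y < δ → y ∈ O k)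
    (hη : ∀ x, (κ (t k - t (k + 1)) x).real {y | δ ≤ dist x y} ≤ η) (x : X) :
    |ψ (k + 1) x| ≤ 2 * M * η := by
  have := h.isFiniteKernel (c.step_pos k)
  have hM0 : 0 ≤ M := (abs_nonneg _).trans (c.abs_le 0 x)
  have hη0 : 0 ≤ η := measureReal_nonneg.trans (hη x)
  by_cases hxO : x ∈ O (k + 1)
  · simp only [cutoffError]
    rw [cutoff_outer _ hxO, zero_sub, abs_neg]
    refine (abs_integral_le_mul_measureReal (δ := δ) (x := x) (c.abs_cutoff_le h k)
      fun y hy => cutoff_outer k (hO x hxO y hy)).trans ?_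
    nlinarith [hη x, mul_nonneg hM0 hη0]
  by_cases hxI : x ∈ I (k + 1)
  · simp only [cutoffError]
    rw [c.cutoff_inner _ hxI, c.step, ← integral_sub
      (integrable_of_bounded h (c.step_pos k) (c.measurable k) (c.abs_le k) x)
      (integrable_of_bounded h (c.step_pos k) (c.measurable_cutoff h k) (c.abs_cutoff_le h k) x)]
    refine (abs_integral_le_mul_measureReal (δ := δ) (x := x) (M := 2 * M) (fun y => ?_)
      fun y hy => ?_).trans ?_
    · refine (abs_sub _ _).trans ?_
      linarith [c.abs_le k y, c.abs_cutoff_le h k y]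
    · rw [c.cutoff_inner _ (hI x hxI y hy), sub_self]
    · gcongr
      exact hη x
  · simp only [cutoffError]
    classical
    rw [cutoff, indicator_of_mem (show x ∈ (O (k + 1))ᶜ from hxO),
      piecewise_eq_of_notMem _ _ _ hxI, sub_self, abs_zero]
    positivity

lemma abs_integral_cutoff_sub_le {k : ℕ} {δ η : ℝ} {x : X} (hI : ∀ y, dist x y < δ → y ∈ I k)
    (hη : (κ (t k) x).real {y | δ ≤ dist x y} ≤ η) :
    |∫ y, φ k y ∂κ (t k) x - ∫ y, H k y ∂κ (t k) x| ≤ 2 * M * η := by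
  have := h.isFiniteKernel (c.pos k)
  have hM0 : 0 ≤ M := (abs_nonneg _).trans (c.abs_le 0 x)
  rw [← integral_sub
    (integrable_of_bounded h (c.pos k) (c.measurable_cutoff h k) (c.abs_cutoff_le h k) x)
    (integrable_of_bounded h (c.pos k) (c.measurable k) (c.abs_le k) x)]
  refine (abs_integral_le_mul_measureReal (δ := δ) (x := x) (M := 2 * M) (fun y => ?_)
    fun y hy => ?_).trans ?_
  · refine (abs_sub _ _).trans ?_
    linarith [c.abs_le k y, c.abs_cutoff_le h k y]
  · rw [c.cutoff_inner _ (hI y hy), sub_self]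
  · gcongr

lemma abs_integral_cutoff_le {k : ℕ} {δ η : ℝ} {x : X} (hO : ∀ y, dist x y < δ → y ∈ O k)
    (hη : (κ (t k) x).real {y | δ ≤ dist x y} ≤ η) :
    |∫ y, φ k y ∂κ (t k) x| ≤ 2 * M * η := by
  have := h.isFiniteKernel (c.pos k)
  have hM0 : 0 ≤ M := (abs_nonneg _).trans (c.abs_le 0 x)
  have hη0 : 0 ≤ η := measureReal_nonneg.trans hη
  refine (abs_integral_le_mul_measureReal (δ := δ) (x := x) (c.abs_cutoff_le h k)
    fun y hy => cutoff_outer k (hO y hy)).trans ?_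
  nlinarith [hη, mul_nonneg hM0 hη0]

end CutoffData

end CutoffMetric

/-! ### Choice of scales and the smooth cut-off -/

section Construction

open ProbabilityTheory

variable {X : Type*} [MeasurableSpace X]

lemma IsHeatKernel.abs_integral_le_of_ae {m : Measure X} {κ : ℝ → Kernel X X}
    (h : IsHeatKernel m κ) {s M : ℝ} (hs : 0 < s) (hM0 : 0 ≤ M) {f : X → ℝ}
    (hM : ∀ᵐ x ∂m, |f x| ≤ M) (x : X) : |∫ y, f y ∂κ s x| ≤ M := by
  have := h.isFiniteKernel hs
  rw [← Real.norm_eq_abs]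
  have hM' : ∀ᵐ y ∂κ s x, ‖f y‖ ≤ M := (h.ac s hs x).ae_le hM
  refine (norm_integral_le_of_norm_le_const hM').trans ?_
  refine mul_le_of_le_one_right hM0 ?_
  exact ENNReal.toReal_le_of_le_ofReal zero_le_one (by simpa using h.univ_le_one s hs x)

lemma IsHeatKernel.integrable_of_ae_bound {m : Measure X} {κ : ℝ → Kernel X X}
    (h : IsHeatKernel m κ) {s M : ℝ} (hs : 0 < s) {f : X → ℝ} (hf : StronglyMeasurable f)
    (hM : ∀ᵐ x ∂m, |f x| ≤ M) (x : X) : Integrable f (κ s x) := by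
  have := h.isFiniteKernel hs
  exact Integrable.of_bound hf.aestronglyMeasurable M ((h.ac s hs x).ae_le hM)

variable [MetricSpace X] [OpensMeasurableSpace X] {m : Measure X} {κ : ℝ → Kernel X X}

/-- The inner and outer regions are disjoint since `ε / 4 < ε - ε / 4`; the evolution rule for `H`
is Chapman–Kolmogorov. -/
lemma CutoffData.of_infDist (h : IsHeatKernel m κ) {K : Set X} {ε s τ M θ : ℝ} (hε : 0 < ε)
    (hτ : 0 < τ) (hτs : τ < s) (hM : 0 ≤ M) (hθ0 : 0 < θ) (hθ1 : θ < 1) {g : X → ℝ}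
    (hg : StronglyMeasurable g) (hgM : ∀ᵐ x ∂m, |g x| ≤ M) :
    CutoffData κ (fun k => τ * (θ ^ 2) ^ k) (fun k => {x | Metric.infDist x K ≤ ε / 2 ^ (k + 2)})
      (fun k => {x | ε - ε / 2 ^ (k + 2) ≤ Metric.infDist x K})
      (fun k x => ∫ y, g y ∂κ (s - τ * (θ ^ 2) ^ k) x) M := by
  have hpos : ∀ k, 0 < τ * (θ ^ 2) ^ k := fun k => by positivity
  have hle : ∀ k, τ * (θ ^ 2) ^ k < s := fun k =>
    (mul_le_of_le_one_right hτ.le (pow_le_one₀ (by positivity)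
      (pow_le_one₀ hθ0.le hθ1.le))).trans_lt hτs
  have hlt : ∀ k, τ * (θ ^ 2) ^ (k + 1) < τ * (θ ^ 2) ^ k := fun k =>
    mul_lt_mul_of_pos_left (pow_lt_pow_right_of_lt_one₀ (by positivity)
      (pow_lt_one₀ hθ0.le hθ1 two_ne_zero) (Nat.lt_succ_self k)) hτ
  refine ⟨hpos, hlt, fun k => ?_, fun k => ?_, fun k => ?_, fun k => ?_, fun k x => ?_,
    fun k x => ?_⟩
  · exact (isClosed_le (Metric.continuous_infDist_pt K) continuous_const).measurableSet
  · exact (isClosed_le continuous_const (Metric.continuous_infDist_pt K)).measurableSet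
  · rw [disjoint_left]
    intro x hx hx'
    simp only [mem_ofPred_eq] at hx hx'
    have : ε / 2 ^ (k + 2) ≤ ε / 4 := by
      have h4 : (4 : ℝ) ≤ 2 ^ (k + 2) := by
        have : (1 : ℝ) ≤ 2 ^ k := one_le_pow₀ one_le_two
        rw [pow_add]; linarith
      gcongr
    linarith
  · have := h.isFiniteKernel (sub_pos.2 (hle k))
    exact hg.integral_kernel.measurable
  · exact h.abs_integral_le_of_ae (sub_pos.2 (hle k)) hM hgM x
  · have e : s - τ * (θ ^ 2) ^ (k + 1) =
        (τ * (θ ^ 2) ^ k - τ * (θ ^ 2) ^ (k + 1)) + (s - τ * (θ ^ 2) ^ k) := by ring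
    rw [e, h.integral_add_time (sub_pos.2 (hlt k)) (sub_pos.2 (hle k))
      (h.integrable_of_ae_bound (add_pos (sub_pos.2 (hlt k)) (sub_pos.2 (hle k))) hg hgM x)]

/-- Times shrink like `θ^(2k)` while distances to the power `dw` shrink like `θ^k`, so the ratio
still decays like `θ^k`. This is why the times have ratio `θ²`. -/
lemma tail_scaling {ε τ q dw : ℝ} (hε : 0 < ε) (hτε : τ ≤ q * ε ^ dw) (k : ℕ) :
    τ * ((((1 : ℝ) / 2) ^ dw) ^ 2) ^ k / (ε / 2 ^ (k + 3)) ^ dw ≤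
      q / (((1 : ℝ) / 2) ^ dw) ^ 4 * (((1 : ℝ) / 2) ^ dw) ^ (k + 1) := by
  set θ : ℝ := ((1 : ℝ) / 2) ^ dw with hθ
  have hθ0 : 0 < θ := by positivity
  have e : (ε / 2 ^ (k + 3)) ^ dw = ε ^ dw * θ ^ (k + 3) := by
    rw [div_eq_mul_one_div, Real.mul_rpow hε.le (by positivity), hθ, ← one_div_pow,
      ← Real.rpow_natCast, ← Real.rpow_natCast (_ ^ dw), ← Real.rpow_mul (by positivity),
      ← Real.rpow_mul (by positivity), mul_comm dw]
  rw [e, div_le_iff₀ (by positivity)]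
  calc τ * (θ ^ 2) ^ k ≤ q * ε ^ dw * (θ ^ 2) ^ k := by gcongr
    _ = q / θ ^ 4 * θ ^ (k + 1) * (ε ^ dw * θ ^ (k + 3)) := by
      field_simp; ring

/-- The decay order `4(ν + l) + 2` becomes `2(ν + l) + 1` under the root: `2(ν + l)` powers of `θ^j`
cancel the singularity in `t j = τ θ^(2j)`, and one is left to sum. -/
lemma term_scaling {c ν τ M V C θ : ℝ} (hτ : 0 < τ) (hθ0 : 0 < θ)
    (l j : ℕ) :
    c / (τ * (θ ^ 2) ^ j / 2) ^ ν * (l.factorial / (τ * (θ ^ 2) ^ j / 2) ^ l *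
      (2 * M * √(C * (θ ^ j) ^ (4 * (ν + l) + 2) * V))) =
    c * l.factorial / (τ / 2) ^ (ν + l) * (2 * M * √(C * V)) * θ ^ j := by
  set p := θ ^ j with hp
  have hp0 : 0 < p := by positivity
  have e1 : τ * (θ ^ 2) ^ j / 2 = τ / 2 * p ^ 2 := by rw [hp]; ring
  have e2 : √(C * p ^ (4 * (ν + l) + 2) * V) = √(C * V) * p ^ (2 * (ν + l) + 1) := by
    have : C * p ^ (4 * (ν + l) + 2) * V = C * V * (p ^ (2 * (ν + l) + 1)) ^ 2 := by
      rw [← Real.rpow_natCast (p ^ (2 * (ν + l) + 1)), ← Real.rpow_mul hp0.le]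
      push_cast; ring_nf
    rw [this, Real.sqrt_mul' _ (sq_nonneg _), Real.sqrt_sq (by positivity)]
  have e3 : (τ / 2 * p ^ 2) ^ (ν + l) = (τ / 2) ^ (ν + l) * p ^ (2 * (ν + l)) := by
    rw [Real.mul_rpow (by positivity) (by positivity), ← Real.rpow_natCast p,
      ← Real.rpow_mul hp0.le]
    norm_cast
  have e4 : (τ / 2 * p ^ 2) ^ ν * (τ / 2 * p ^ 2) ^ l = (τ / 2) ^ (ν + l) * p ^ (2 * (ν + l)) := by
    rw [← e3, Real.rpow_add (by positivity), Real.rpow_natCast]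
  have hne : (τ / 2) ^ (ν + l) ≠ 0 := (Real.rpow_pos_of_pos (half_pos hτ) _).ne'
  have hne2 : p ^ (2 * (ν + l)) ≠ 0 := (Real.rpow_pos_of_pos hp0 _).ne'
  rw [e1, e2, Real.rpow_add hp0 (2 * (ν + l)) 1, Real.rpow_one]
  calc _ = c * l.factorial / ((τ / 2 * p ^ 2) ^ ν * (τ / 2 * p ^ 2) ^ l) *
        (2 * M * (√(C * V) * (p ^ (2 * (ν + l)) * p))) := by ring
    _ = _ := by rw [e4]; field_simp

/-- The bound for the `l`-th function of the family constructed below. -/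
noncomputable def smoothBound (c ν dw q : ℝ) (a : ℝ → ℝ) (τ M V : ℝ) (l : ℕ) : ℝ :=
  c * l.factorial / (τ / 2) ^ (ν + l) * (2 * M * √((1 + a (4 * (ν + l) + 2) *
    (q / (((1 : ℝ) / 2) ^ dw) ^ 4) ^ (4 * (ν + l) + 2)) * V)) * (1 - ((1 : ℝ) / 2) ^ dw)⁻¹

/-- A smooth cut-off of `T_s g` that is equal to it on `K` and vanishes at distance at least `ε`
from `K`. -/
theorem exists_smooth_cutoff [SFinite m] (h : IsHeatKernel m κ) {c ν dw q : ℝ} {T : ℝ≥0∞}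
    (hu : IsUltracontractive m κ c ν T) (hc : 0 ≤ c) (hν : 0 ≤ ν) (hdw : 0 < dw) {a : ℝ → ℝ}
    (ha : HasTailBounds κ dw a T) (ha0 : ∀ N, 0 ≤ a N)
    {K : Set X} {ε s τ M : ℝ} (hε : 0 < ε) (hτ : 0 < τ) (hτs : τ < s)
    (hτT : ENNReal.ofReal τ < T) (hτε : τ ≤ q * ε ^ dw) (hM : 0 ≤ M) {g : X → ℝ}
    (hg : StronglyMeasurable g) (hgM : ∀ᵐ x ∂m, |g x| ≤ M)
    (hW : m {x | Metric.infDist x K < ε} < ∞) :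
    ∃ U : ℕ → X → ℝ, IsSmoothFamily κ U
        (smoothBound c ν dw q a τ M (m {x | Metric.infDist x K < ε}).toReal) (τ / 2) ∧
      (∀ x ∈ K, U 0 x = ∫ y, g y ∂κ s x) ∧ (∀ x, ε ≤ Metric.infDist x K → U 0 x = 0) ∧
      (∀ x, |U 0 x| ≤ M) ∧ (0 ≤ᵐ[m] g → ∀ x, 0 ≤ U 0 x) := by
  set W := {x | Metric.infDist x K < ε} with hWdef
  set V := (m W).toReal
  set θ : ℝ := ((1 : ℝ) / 2) ^ dw with hθ
  have hθ0 : 0 < θ := by positivity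
  have hθ1 : θ < 1 := Real.rpow_lt_one (by norm_num) (by norm_num) hdw
  have hq : 0 ≤ q := by
    by_contra! hq
    have : 0 < ε ^ dw := Real.rpow_pos_of_pos hε dw
    nlinarith
  set D := CutoffData.of_infDist h (K := K) hε hτ hτs hM hθ0 hθ1 hg hgM
  set t : ℕ → ℝ := fun k => τ * (θ ^ 2) ^ k with ht
  set I : ℕ → Set X := fun k => {x | Metric.infDist x K ≤ ε / 2 ^ (k + 2)} with hI
  set O : ℕ → Set X := fun k => {x | ε - ε / 2 ^ (k + 2) ≤ Metric.infDist x K} with hO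
  set H : ℕ → X → ℝ := fun k x => ∫ y, g y ∂κ (s - τ * (θ ^ 2) ^ k) x with hH
  set φ := cutoff κ (fun k => t k - t (k + 1)) I O H with hφ
  set ψ := cutoffError κ (fun k => t k - t (k + 1)) I O H with hψ
  have htpos : ∀ k, 0 < t k := D.pos
  have htτ : ∀ k, t k ≤ τ := fun k =>
    mul_le_of_le_one_right hτ.le (pow_le_one₀ (by positivity) (pow_le_one₀ hθ0.le hθ1.le))
  have hδ : ∀ k : ℕ, 0 < ε / 2 ^ (k + 3) := fun k => by positivity
  have hhalf : ∀ k : ℕ, ε / 2 ^ (k + 3) + ε / 2 ^ (k + 3) = ε / 2 ^ (k + 2) := fun k => by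
    rw [pow_succ 2 (k + 2)]; ring

  have htail : ∀ N, 0 < N → ∀ k r, 0 < r → r ≤ t k → ∀ x,
      (κ r x).real {y | ε / 2 ^ (k + 3) ≤ dist x y} ≤
        a N * (q / θ ^ 4) ^ N * (θ ^ (k + 1)) ^ N := by
    intro N hN k r hr hrt x
    refine (ha N hN r hr ((ENNReal.ofReal_le_ofReal (hrt.trans (htτ k))).trans_lt hτT) _ (hδ k)
      x).trans ?_
    rw [mul_assoc, ← Real.mul_rpow (by positivity) (by positivity)]
    have := ha0 N
    gcongr
    refine le_trans ?_ (tail_scaling hε hτε k)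
    gcongr
  -- The summand `1` covers `j = 0`, where `ψ 0 = φ 0` has no smallness.
  set C : ℝ → ℝ := fun N => 1 + a N * (q / θ ^ 4) ^ N with hC
  have hC0 : ∀ N, 1 ≤ C N := fun N => by
    have := ha0 N
    simp only [hC]
    have : 0 ≤ a N * (q / θ ^ 4) ^ N := by positivity
    linarith
  have hψN : ∀ N, 0 < N → ∀ j x, |ψ j x| ≤ 2 * M * (C N * (θ ^ j) ^ N) := by
    intro N hN j x
    cases j with
    | zero =>
      refine (D.abs_cutoffError_le_two h 0 x).trans ?_
      rw [pow_zero, Real.one_rpow, mul_one]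
      exact le_mul_of_one_le_right (by positivity) (hC0 N)
    | succ k =>
      refine (D.abs_cutoffError_succ_le h (fun y hy z hz => ?_) (fun y hy z hz => ?_)
        (fun y => htail N hN k _ (D.step_pos k) (by linarith [htpos (k + 1)]) y) x).trans ?_
      · have := Metric.infDist_le_infDist_add_dist (s := K) (x := z) (y := y)
        rw [dist_comm] at this
        have hy' : Metric.infDist y K ≤ ε / 2 ^ (k + 3) := hy
        change Metric.infDist z K ≤ ε / 2 ^ (k + 2)
        linarith [hhalf k]
      · have := Metric.infDist_le_infDist_add_dist (s := K) (x := y) (y := z)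
        have hy' : ε - ε / 2 ^ (k + 3) ≤ Metric.infDist y K := hy
        change ε - ε / 2 ^ (k + 2) ≤ Metric.infDist z K
        linarith [hhalf k]
      · gcongr
        simp only [hC]
        linarith
  have hWm : MeasurableSet W :=
    (isOpen_lt (Metric.continuous_infDist_pt K) continuous_const).measurableSet
  have hOW : ∀ k, (O k)ᶜ ⊆ W := by
    intro k x hx
    simp only [hO, mem_compl_iff, mem_ofPred_eq, not_le] at hx
    have : 0 < ε / 2 ^ (k + 2) := by positivity
    simp only [hWdef, mem_ofPred_eq]
    linarith
  have hnorm : ∀ N, 0 < N → ∀ j, eLpNorm (fun x => (ψ j x : ℂ)) 2 m ≤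
      ENNReal.ofReal (2 * M * √(C N * (θ ^ j) ^ N * V)) := by
    intro N hN j
    have := hC0 N
    exact D.eLpNorm_cutoffError_le h hWm hOW hW hM (by positivity) (hψN N hN j)
  have hmem : ∀ j, MemLp (fun x => (ψ j x : ℂ)) 2 m := fun j =>
    ⟨(Complex.measurable_ofReal.comp (D.measurable_cutoffError h j)).aestronglyMeasurable,
      (hnorm 1 one_pos j).trans_lt ENNReal.ofReal_lt_top⟩
  set F : ℕ → Lp ℂ 2 m := fun j => (hmem j).toLp with hF
  have hFnorm : ∀ N, 0 < N → ∀ j, ‖F j‖ ≤ 2 * M * √(C N * (θ ^ j) ^ N * V) := by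
    intro N hN j
    rw [hF, Lp.norm_toLp]
    exact ENNReal.toReal_le_of_le_ofReal (by positivity) (hnorm N hN j)
  set B : ℕ → ℝ := fun l => c * l.factorial / (τ / 2) ^ (ν + l) *
    (2 * M * √(C (4 * (ν + l) + 2) * V)) with hB
  have hterm : ∀ l j, c / (t j / 2) ^ ν * (l.factorial / (t j / 2) ^ l * ‖F j‖) ≤ B l * θ ^ j := by
    intro l j
    have h1 := hFnorm (4 * (ν + l) + 2) (by positivity) j
    have h2 := htpos j
    refine le_trans ?_ (term_scaling (c := c) (M := M) (V := V) hτ hθ0 l j).le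
    gcongr
  -- The time `t j` is split in half: one half pays for the derivatives on `L²`, the other for
  -- passing to `L^∞`.
  have hfam : ∀ j, IsSmoothFamily κ (fun l => smoothed h l (t j / 2) (t j / 2) (F j))
      (fun l => B l * θ ^ j) (τ / 2) := by
    intro j
    have hj := half_pos (htpos j)
    have hjT : ENNReal.ofReal (t j / 2) < T :=
      (ENNReal.ofReal_le_ofReal (by linarith [htτ j])).trans_lt hτT
    refine ⟨fun l => h.continuous_smoothed hu hc hj hjT l _ _, fun l x => ?_, fun l r hr hrR x => ?_⟩
    · exact (h.abs_smoothed_le hu hc hj hjT l hj _ x).trans (hterm l j)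
    · refine (h.abs_integral_smoothed_sub_le hu hc hj hjT l hj hr
        ((ENNReal.ofReal_le_ofReal (by linarith [htτ j])).trans_lt hτT) _ x).trans ?_
      exact mul_le_mul_of_nonneg_left (hterm (l + 2) j) (sq_nonneg r)
  have hgeom : Summable fun j : ℕ => θ ^ j := summable_geometric_of_lt_one hθ0.le hθ1
  have hsumfam := IsSmoothFamily.tsum (fun s hs => h.isFiniteKernel hs) hfam
    (fun l => hgeom.mul_left (B l))
  have hbound : (fun l => ∑' j, B l * θ ^ j) = smoothBound c ν dw q a τ M V := by
    ext l
    rw [tsum_mul_left, tsum_geometric_of_lt_one hθ0.le hθ1]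
    rfl
  rw [hbound] at hsumfam
  refine ⟨_, hsumfam, ?_⟩
  have hzero : ∀ j x, smoothed h 0 (t j / 2) (t j / 2) (F j) x = ∫ y, ψ j y ∂κ (t j) x := by
    intro j x
    have hj := half_pos (htpos j)
    rw [hF, h.smoothed_zero hj hj (hmem j), add_halves]
    rw [add_halves]
    exact CutoffData.integrable_of_bounded h (htpos j) (D.measurable_cutoffError h j)
      (D.abs_cutoffError_le_two h j) x
  -- All pointwise properties of the sum are read off from the evolved `φ k` through this limit.
  have hlim : ∀ x, Tendsto (fun k => ∫ y, φ k y ∂κ (t k) x) atTop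
      (𝓝 (∑' j, smoothed h 0 (t j / 2) (t j / 2) (F j) x)) := by
    intro x
    have hs : Summable fun j => smoothed h 0 (t j / 2) (t j / 2) (F j) x :=
      Summable.of_norm_bounded (hgeom.mul_left (B 0)) fun j => (hfam j).abs_le 0 x
    have h1 := (tendsto_add_atTop_iff_nat 1).2 hs.hasSum.tendsto_sum_nat
    refine h1.congr fun k => ?_
    rw [← D.sum_integral_cutoffError h k x]
    exact Finset.sum_congr rfl fun j _ => hzero j x
  have hη : Tendsto (fun k : ℕ => 2 * M * (a 1 * (q / θ ^ 4) ^ (1 : ℝ) * (θ ^ (k + 1)) ^ (1 : ℝ)))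
      atTop (𝓝 0) := by
    have h1 := (tendsto_add_atTop_iff_nat 1).2 (tendsto_pow_atTop_nhds_zero_of_lt_one hθ0.le hθ1)
    have h2 := (h1.const_mul (a 1 * (q / θ ^ 4) ^ (1 : ℝ))).const_mul (2 * M)
    simp only [mul_zero] at h2
    simpa only [Real.rpow_one] using h2
  refine ⟨fun x hx => ?_, fun x hx => ?_, fun x => ?_, fun hg0 x => ?_⟩
  -- For every `k` the evolution of `H k` for time `t k` is `T_s g`, so only the tail beyond the
  -- inner region matters.
  · have h1 : ∀ k, ‖∫ y, φ k y ∂κ (t k) x - ∫ y, g y ∂κ s x‖ ≤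
        2 * M * (a 1 * (q / θ ^ 4) ^ (1 : ℝ) * (θ ^ (k + 1)) ^ (1 : ℝ)) := by
      intro k
      have hsk : 0 < s - t k := by linarith [htτ k]
      have e : ∫ y, g y ∂κ s x = ∫ y, H k y ∂κ (t k) x := by
        have h3 := h.integral_add_time (f := g) (x := x) (htpos k) hsk
          (h.integrable_of_ae_bound (add_pos (htpos k) hsk) hg hgM x)
        rwa [add_sub_cancel] at h3
      rw [e]
      refine D.abs_integral_cutoff_sub_le h (fun y hy => ?_)
        (htail 1 one_pos k (t k) (htpos k) le_rfl x)
      change Metric.infDist y K ≤ ε / 2 ^ (k + 2)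
      have := Metric.infDist_le_dist_of_mem (x := y) hx
      rw [dist_comm] at this
      linarith [hhalf k, hδ k]
    have h2 := (hlim x).sub_const (∫ y, g y ∂κ s x)
    have h3 := squeeze_zero_norm h1 hη
    exact sub_eq_zero.1 (tendsto_nhds_unique h2 h3)
  · have h1 : ∀ k, ‖∫ y, φ k y ∂κ (t k) x‖ ≤
        2 * M * (a 1 * (q / θ ^ 4) ^ (1 : ℝ) * (θ ^ (k + 1)) ^ (1 : ℝ)) := by
      intro k
      refine D.abs_integral_cutoff_le h (fun y hy => ?_)
        (htail 1 one_pos k (t k) (htpos k) le_rfl x)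
      change ε - ε / 2 ^ (k + 2) ≤ Metric.infDist y K
      have := Metric.infDist_le_infDist_add_dist (s := K) (x := x) (y := y)
      linarith [hhalf k, hδ k]
    exact tendsto_nhds_unique (hlim x) (squeeze_zero_norm h1 hη)
  · refine le_of_tendsto (hlim x).abs (Eventually.of_forall fun k => ?_)
    exact CutoffData.abs_integral_le h (htpos k) (D.abs_cutoff_le h k) x
  · refine ge_of_tendsto (hlim x) (Eventually.of_forall fun k => integral_nonneg fun y => ?_)
    refine CutoffData.cutoff_nonneg (fun j z => ?_) k y
    have hsk : 0 < s - t j := by linarith [htτ j]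
    exact integral_nonneg_of_ae ((h.ac _ hsk z).ae_le hg0)

end Construction

/-! ### From the process to its transition density -/

section DiffusionKernel

open ProbabilityTheory

namespace Diffusion

variable {X : Type*} [TopologicalSpace X] [MeasurableSpace X] {Ω : Type*} [mΩ : MeasurableSpace Ω]
  (Z : Diffusion X Ω)

lemma measurableSet_path_mem (t : ℝ≥0) {A : Set X} (hA : MeasurableSet A) :
    MeasurableSet {ω | ∃ y ∈ A, Z.path t ω = (y : OnePoint X)} :=
  Z.filtration.le t _ (Z.adapted t A hA)

/-- The position at time `t`, with the value `x` in place of the cemetery. -/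
noncomputable def position (t : ℝ≥0) (x : X) (ω : Ω) : X := (Z.path t ω).elim x id

lemma position_preimage (t : ℝ≥0) (x : X) (A : Set X) :
    Z.position t x ⁻¹' A ∩ {ω | ∃ y ∈ (univ : Set X), Z.path t ω = (y : OnePoint X)} =
      {ω | ∃ y ∈ A, Z.path t ω = (y : OnePoint X)} := by
  ext ω
  constructor
  · rintro ⟨h1, y, -, hy⟩
    refine ⟨y, ?_, hy⟩
    simpa [position, hy] using h1
  · rintro ⟨y, hyA, hy⟩
    exact ⟨by simpa [position, hy] using hyA, y, mem_univ y, hy⟩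

lemma path_eq_infty (t : ℝ≥0) {ω : Ω}
    (hω : ¬ ∃ y ∈ (univ : Set X), Z.path t ω = (y : OnePoint X)) :
    Z.path t ω = OnePoint.infty := by
  by_contra hne
  obtain ⟨y, hy⟩ := OnePoint.ne_infty_iff_exists.1 hne
  exact hω ⟨y, mem_univ y, hy.symm⟩

lemma measurable_position (t : ℝ≥0) (x : X) : Measurable (Z.position t x) := by
  intro A hA
  have hE := Z.measurableSet_path_mem t (MeasurableSet.univ (α := X))
  rw [← inter_union_compl (Z.position t x ⁻¹' A)
    {ω | ∃ y ∈ (univ : Set X), Z.path t ω = (y : OnePoint X)}, position_preimage]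
  refine (Z.measurableSet_path_mem t hA).union ?_
  have hinf : ∀ ω, ω ∈ {ω | ∃ y ∈ (univ : Set X), Z.path t ω = (y : OnePoint X)}ᶜ →
      Z.position t x ω = x := by
    intro ω hω
    rw [position, Z.path_eq_infty t hω]
    rfl
  by_cases hx : x ∈ A
  · rw [inter_eq_right.2 fun ω hω => by rw [mem_preimage, hinf ω hω]; exact hx]
    exact hE.compl
  · rw [show Z.position t x ⁻¹' A ∩ _ = ∅ from eq_empty_of_forall_notMem fun ω hω =>
      hx (by rw [← hinf ω hω.2]; exact hω.1)]
    exact MeasurableSet.empty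

/-- Replaces expectations over `X ∪ {∂}` by those of an `X`-valued measurable map restricted to
survival. -/
lemma elim_eq_indicator {β : Type*} [Zero β] (t : ℝ≥0) (x : X) (G : X → β) (ω : Ω) :
    (Z.path t ω).elim 0 G = {ω | ∃ y ∈ (univ : Set X), Z.path t ω = (y : OnePoint X)}.indicator
      (fun ω => G (Z.position t x ω)) ω := by
  by_cases hω : ∃ y ∈ (univ : Set X), Z.path t ω = (y : OnePoint X)
  · rw [indicator_of_mem (by exact hω)]
    obtain ⟨y, -, hy⟩ := hω
    simp [position, hy]
  · rw [indicator_of_notMem (by exact hω)]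
    rw [Z.path_eq_infty t hω]
    rfl

variable {m : Measure X} {p : ℝ≥0 → X → X → ℝ} (hp : Z.IsTransitionDensity m p)
include hp

lemma map_position {t : ℝ≥0} (ht : 0 < t) (x : X) :
    ((Z.law x).restrict {ω | ∃ y ∈ (univ : Set X), Z.path t ω = (y : OnePoint X)}).map
      (Z.position t x) = m.withDensity fun y => ENNReal.ofReal (p t x y) := by
  ext A hA
  rw [Measure.map_apply (Z.measurable_position t x) hA,
    Measure.restrict_apply (Z.measurable_position t x hA), position_preimage,
    hp.law_eq t ht x A hA, withDensity_apply _ hA]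

lemma lintegral_elim {t : ℝ≥0} (ht : 0 < t) (x : X) {G : X → ℝ≥0∞} (hG : Measurable G) :
    ∫⁻ ω, (Z.path t ω).elim 0 G ∂Z.law x =
      ∫⁻ y, G y ∂m.withDensity fun y => ENNReal.ofReal (p t x y) := by
  simp_rw [Z.elim_eq_indicator t x G]
  rw [lintegral_indicator (Z.measurableSet_path_mem t MeasurableSet.univ), ← Z.map_position hp ht,
    lintegral_map hG (Z.measurable_position t x)]

lemma semigroup_eq_integral {t : ℝ≥0} (ht : 0 < t) (x : X) {f : X → ℝ} (hf : Measurable f) :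
    Z.semigroup t f x = ∫ y, f y ∂m.withDensity fun y => ENNReal.ofReal (p t x y) := by
  rw [semigroup]
  simp_rw [Z.elim_eq_indicator t x f]
  rw [integral_indicator (Z.measurableSet_path_mem t MeasurableSet.univ), ← Z.map_position hp ht,
    integral_map (Z.measurable_position t x).aemeasurable hf.aestronglyMeasurable]

lemma withDensity_univ_le {t : ℝ≥0} (ht : 0 < t) (x : X) :
    ∫⁻ y, ENNReal.ofReal (p t x y) ∂m ≤ 1 := by
  rw [← setLIntegral_univ, ← hp.law_eq t ht x univ MeasurableSet.univ]
  have := Z.isProbabilityMeasure x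
  exact prob_le_one

end Diffusion

end DiffusionKernel

/-! ### The transition density as a heat kernel -/

section TransitionKernel

open ProbabilityTheory

variable {X : Type*} [MetricSpace X] [ProperSpace X] [MeasurableSpace X] [BorelSpace X]

/-- The kernel with density `p t` with respect to `m`. -/
noncomputable def transitionKernel (m : Measure X) [SFinite m] (p : ℝ≥0 → X → X → ℝ) (t : ℝ) :
    Kernel X X :=
  Kernel.withDensity (Kernel.const X m) fun x y => ENNReal.ofReal (p t.toNNReal x y)

variable {m : Measure X} [SFinite m] {Ω : Type*} [MeasurableSpace Ω] {p : ℝ≥0 → X → X → ℝ}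

section

variable (hcont : ∀ t : ℝ≥0, 0 < t → Continuous fun z : X × X => p t z.1 z.2)
include hcont

omit [SFinite m] in
lemma measurable_ofReal_density {t : ℝ} (ht : 0 < t) :
    Measurable (Function.uncurry fun x y => ENNReal.ofReal (p t.toNNReal x y)) :=
  (hcont _ (Real.toNNReal_pos.2 ht)).measurable.ennreal_ofReal

lemma transitionKernel_apply {t : ℝ} (ht : 0 < t) (x : X) : transitionKernel m p t x =
    m.withDensity fun y => ENNReal.ofReal (p t.toNNReal x y) := by
  rw [transitionKernel, Kernel.withDensity_apply _ (measurable_ofReal_density hcont ht)]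
  rfl

lemma Diffusion.isHeatKernel (Z : Diffusion X Ω) (hp : Z.IsTransitionDensity m p)
    (hsymm : ∀ t : ℝ≥0, 0 < t → ∀ x y, p t x y = p t y x) :
    IsHeatKernel m (transitionKernel m p) := by
  have hfin : ∀ t, 0 < t → IsFiniteKernel (transitionKernel m p t) := fun t ht =>
    ⟨⟨1, ENNReal.one_lt_top, fun x => by
      rw [transitionKernel_apply hcont ht, withDensity_apply _ MeasurableSet.univ, setLIntegral_univ]
      exact Z.withDensity_univ_le hp (Real.toNNReal_pos.2 ht) x⟩⟩
  refine ⟨fun t ht x => ?_, fun t ht x => ?_, fun s t hs ht => ?_, fun t ht => ?_⟩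
  · rw [transitionKernel_apply hcont ht, withDensity_apply _ MeasurableSet.univ, setLIntegral_univ]
    exact Z.withDensity_univ_le hp (Real.toNNReal_pos.2 ht) x
  · rw [transitionKernel_apply hcont ht]
    exact withDensity_absolutelyContinuous _ _
  · have hs' := Real.toNNReal_pos.2 hs
    have ht' := Real.toNNReal_pos.2 ht
    ext x A hA
    have hA' : ∀ u, 0 < u → ∀ z, Z.law z {ω | ∃ y ∈ A, Z.path u.toNNReal ω = (y : OnePoint X)} =
        transitionKernel m p u z A := fun u hu z => by
      rw [hp.law_eq _ (Real.toNNReal_pos.2 hu) z A hA, transitionKernel_apply hcont hu,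
        withDensity_apply _ hA]
    -- With the trivial event, the Markov property is Chapman–Kolmogorov.
    have h1 := Z.markov x s.toNNReal t.toNNReal univ MeasurableSet.univ A hA
    rw [univ_inter, Measure.restrict_univ, ← Real.toNNReal_add hs.le ht.le,
      hA' _ (add_pos hs ht)] at h1
    rw [h1, Z.lintegral_elim hp hs' x (Z.measurable_law _ A hA), Kernel.comp_apply' _ _ _ hA,
      ← transitionKernel_apply hcont hs]
    exact lintegral_congr fun z => hA' t ht z
  · have := hfin t ht
    have hmeas := measurable_ofReal_density hcont ht
    have key : ∀ F : X × X → ℝ≥0∞, Measurable F → ∫⁻ z, F z ∂(m ⊗ₘ transitionKernel m p t) =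
        ∫⁻ x, ∫⁻ y, ENNReal.ofReal (p t.toNNReal x y) * F (x, y) ∂m ∂m := by
      intro F hF
      rw [Measure.lintegral_compProd hF]
      refine lintegral_congr fun x => ?_
      rw [transitionKernel_apply hcont ht]
      exact lintegral_withDensity_eq_lintegral_mul _ (hmeas.comp measurable_prodMk_left)
        (hF.comp measurable_prodMk_left)
    refine Measure.ext_of_lintegral _ fun F hF => ?_
    rw [lintegral_map hF measurable_swap, key (fun z => F z.swap) (hF.comp measurable_swap), key _ hF,
      lintegral_lintegral_swap]
    · refine lintegral_congr fun x => lintegral_congr fun y => ?_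
      rw [hsymm _ (Real.toNNReal_pos.2 ht)]
      rfl
    · exact (hmeas.mul (hF.comp measurable_swap)).aemeasurable

end

end TransitionKernel

/-! ### Consequences of the sub-Gaussian bounds -/

section SubGaussian

open ProbabilityTheory

/-- Raise `u ≤ e^u`, for `u = w / A`, to the power `A`. -/
lemma exp_neg_le_rpow {A w : ℝ} (hA : 0 < A) (hw : 0 < w) :
    Real.exp (-w) ≤ A ^ A * w ^ (-A) := by
  have h1 : w / A ≤ Real.exp (w / A) := by linarith [Real.add_one_le_exp (w / A)]
  have h2 : (w / A) ^ A ≤ Real.exp w := by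
    refine (Real.rpow_le_rpow (by positivity) h1 hA.le).trans_eq ?_
    rw [← Real.exp_mul, div_mul_cancel₀ _ hA.ne']
  rw [Real.div_rpow hw.le hA.le, div_le_iff₀ (by positivity)] at h2
  have e : Real.exp w * Real.exp (-w) = 1 := by rw [← Real.exp_add]; simp
  rw [Real.rpow_neg hw.le, ← div_eq_mul_inv, le_div_iff₀ (by positivity)]
  calc Real.exp (-w) * w ^ A ≤ Real.exp (-w) * (Real.exp w * A ^ A) := by gcongr
    _ = A ^ A := by rw [← mul_assoc, mul_comm (Real.exp (-w)), e, one_mul]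

/-- The order `N (dw - 1)` in `exp_neg_le_rpow` cancels the exponent `1 / (dw - 1)`. -/
lemma exp_neg_rpow_le {dw b z N : ℝ} (hdw : 1 < dw) (hb : 0 < b) (hz : 0 < z) (hN : 0 < N) :
    Real.exp (-(b * z ^ (1 / (dw - 1)))) ≤
      (N * (dw - 1)) ^ (N * (dw - 1)) * b ^ (-(N * (dw - 1))) * (1 / z) ^ N := by
  have hd : 0 < dw - 1 := by linarith
  refine (exp_neg_le_rpow (A := N * (dw - 1)) (by positivity) (by positivity)).trans_eq ?_
  rw [Real.mul_rpow hb.le (by positivity), ← Real.rpow_mul hz.le, one_div z, Real.inv_rpow hz.le,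
    ← Real.rpow_neg hz.le]
  have : 1 / (dw - 1) * -(N * (dw - 1)) = -N := by field_simp
  rw [this, mul_assoc]

/-- The two-sided sub-Gaussian bounds, with explicit constants. -/
def SubGaussianBoundsWith {X : Type*} [MetricSpace X] (n dw : ℝ) (p : ℝ≥0 → X → X → ℝ)
    (c₁ c₂ c₃ c₄ : ℝ) (t₀ : ℝ≥0∞) : Prop :=
  ∀ t : ℝ, 0 < t → ENNReal.ofReal t < t₀ → ∀ x y : X,
    c₁ / t ^ (n / dw) * Real.exp (-c₂ * (dist x y ^ dw / t) ^ (1 / (dw - 1))) ≤ p t.toNNReal x y ∧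
      p t.toNNReal x y ≤
        c₃ / t ^ (n / dw) * Real.exp (-c₄ * (dist x y ^ dw / t) ^ (1 / (dw - 1)))

variable {X : Type*} [MetricSpace X] {n dw c₁ c₂ c₃ c₄ : ℝ} {p : ℝ≥0 → X → X → ℝ} {t₀ : ℝ≥0∞}
  (hb : SubGaussianBoundsWith n dw p c₁ c₂ c₃ c₄ t₀)
include hb

/-- Away from the diagonal the density at time `t` is exponentially smaller than the density at
time `L ^ (dw - 1) * t`, for large `L`. -/
lemma SubGaussianBoundsWith.le_exp_mul (hdw : 1 < dw) (h1 : 0 < c₁) (h3 : 0 < c₃)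
    (h4 : 0 < c₄) {t δ L : ℝ} (ht : 0 < t) (hL : 1 ≤ L) (hcL : c₂ / L ≤ c₄ / 2)
    (htT : ENNReal.ofReal (L ^ (dw - 1) * t) < t₀) (hδ : 0 < δ) {x y : X} (hxy : δ ≤ dist x y) :
    p t.toNNReal x y ≤ Real.exp (-(c₄ / 2 * (δ ^ dw / t) ^ (1 / (dw - 1)))) *
      (c₃ / c₁ * (L ^ (dw - 1)) ^ (n / dw)) * p (L ^ (dw - 1) * t).toNNReal x y := by
  have hd : 0 < dw - 1 := by linarith
  set Λ := L ^ (dw - 1) with hΛ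
  have hΛ1 : 1 ≤ Λ := Real.one_le_rpow hL hd.le
  have hL0 : 0 < L := by linarith
  have htT' : ENNReal.ofReal t < t₀ :=
    (ENNReal.ofReal_le_ofReal (le_mul_of_one_le_left ht.le hΛ1)).trans_lt htT
  have hup := (hb t ht htT' x y).2
  have hlo := (hb (Λ * t) (by positivity) htT x y).1
  have hd0 : 0 ≤ dist x y := dist_nonneg
  set Y := (dist x y ^ dw / t) ^ (1 / (dw - 1)) with hY
  -- Multiplying the time by `Λ` divides the exponent by `L`. Half of `c₄ * Y` pays for the lower
  -- bound at the later time; the other half is the gain.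
  have hYL : (dist x y ^ dw / (Λ * t)) ^ (1 / (dw - 1)) = Y / L := by
    rw [mul_comm Λ, ← div_div, Real.div_rpow (by positivity) (by positivity), ← hY, hΛ,
      ← Real.rpow_mul hL0.le, mul_one_div_cancel hd.ne', Real.rpow_one]
  have hY0 : 0 ≤ Y := by positivity
  have hYδ : (δ ^ dw / t) ^ (1 / (dw - 1)) ≤ Y := by
    rw [hY]; gcongr
  rw [hYL, Real.mul_rpow (by positivity) ht.le] at hlo
  have hexp : Real.exp (-c₄ * Y) ≤ Real.exp (-(c₄ / 2 * (δ ^ dw / t) ^ (1 / (dw - 1)))) *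
      Real.exp (-c₂ * (Y / L)) := by
    rw [← Real.exp_add]
    apply Real.exp_le_exp.2
    have e1 : c₂ * (Y / L) ≤ c₄ / 2 * Y := by
      calc c₂ * (Y / L) = c₂ / L * Y := by ring
        _ ≤ _ := by gcongr
    have e2 : c₄ / 2 * (δ ^ dw / t) ^ (1 / (dw - 1)) ≤ c₄ / 2 * Y := by gcongr
    linarith
  set G := Real.exp (-(c₄ / 2 * (δ ^ dw / t) ^ (1 / (dw - 1))))
  have hΛn : 0 < Λ ^ (n / dw) := by positivity
  have htn : 0 < t ^ (n / dw) := by positivity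
  calc p t.toNNReal x y ≤ c₃ / t ^ (n / dw) * Real.exp (-c₄ * Y) := hup
    _ ≤ c₃ / t ^ (n / dw) * (G * Real.exp (-c₂ * (Y / L))) := by gcongr
    _ = G * (c₃ / c₁ * Λ ^ (n / dw)) *
        (c₁ / (Λ ^ (n / dw) * t ^ (n / dw)) * Real.exp (-c₂ * (Y / L))) := by
      field_simp
    _ ≤ _ := by gcongr

lemma SubGaussianBoundsWith.le_const (h3 : 0 < c₃) (h4 : 0 < c₄) {t : ℝ} (ht : 0 < t)
    (htT : ENNReal.ofReal t < t₀) (x y : X) : p t.toNNReal x y ≤ c₃ / t ^ (n / dw) := by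
  refine (hb t ht htT x y).2.trans (mul_le_of_le_one_right (by positivity) ?_)
  rw [Real.exp_le_one_iff, neg_mul]
  have : 0 ≤ (dist x y ^ dw / t) ^ (1 / (dw - 1)) := by positivity
  nlinarith

variable [MeasurableSpace X] {m : Measure X}

/-- The measure of a bounded set, from the lower bound on the density. -/
lemma SubGaussianBoundsWith.measure_le (h1 : 0 < c₁) (h2 : 0 < c₂) (hdw : 1 < dw) {t : ℝ}
    (ht : 0 < t) (htT : ENNReal.ofReal t < t₀)
    (hp1 : ∀ t : ℝ≥0, 0 < t → ∀ x, ∫⁻ y, ENNReal.ofReal (p t x y) ∂m ≤ 1)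
    {x : X} {R : ℝ} {W : Set X} (hWm : MeasurableSet W) (hW : ∀ y ∈ W, dist x y ≤ R) :
    m W ≤ ENNReal.ofReal
      (t ^ (n / dw) / c₁ * Real.exp (c₂ * (R ^ dw / t) ^ (1 / (dw - 1)))) := by
  have hd : 0 < dw - 1 := by linarith
  -- `ρ` bounds the density from below on `W`, and the density has total mass at most `1`.
  set ρ := c₁ / t ^ (n / dw) * Real.exp (-(c₂ * (R ^ dw / t) ^ (1 / (dw - 1)))) with hρ
  have hρ0 : 0 < ρ := by positivity
  have h : ENNReal.ofReal ρ * m W ≤ 1 := by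
    refine le_trans ?_ (hp1 _ (Real.toNNReal_pos.2 ht) x)
    rw [← setLIntegral_const]
    refine (setLIntegral_mono' hWm fun y hy => ?_).trans (setLIntegral_le_lintegral W _)
    apply ENNReal.ofReal_le_ofReal
    refine le_trans ?_ (hb t ht htT x y).1
    rw [hρ, neg_mul]
    have := hW y hy
    have hR : 0 ≤ R := dist_nonneg.trans this
    gcongr
  have e : t ^ (n / dw) / c₁ * Real.exp (c₂ * (R ^ dw / t) ^ (1 / (dw - 1))) = ρ⁻¹ := by
    rw [hρ, Real.exp_neg, mul_inv, inv_inv, inv_div]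
  rw [e, ENNReal.ofReal_inv_of_pos hρ0, ENNReal.le_inv_iff_mul_le, mul_comm]
  exact h

variable [ProperSpace X] [BorelSpace X] [SFinite m]
  (hcont : ∀ t : ℝ≥0, 0 < t → Continuous fun z : X × X => p t z.1 z.2)
include hcont

lemma SubGaussianBoundsWith.isUltracontractive (h3 : 0 < c₃) (h4 : 0 < c₄)
    (hp0 : ∀ t : ℝ≥0, 0 < t → ∀ x y, 0 ≤ p t x y) :
    IsUltracontractive m (transitionKernel m p) (√c₃) (n / (2 * dw)) t₀ := by
  refine ⟨fun t ht htT x => ?_, fun t ht htT s hs hms => ?_⟩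
  · rw [transitionKernel_apply hcont ht, ← withDensity_const]
    refine withDensity_mono (Eventually.of_forall fun y => ENNReal.ofReal_le_ofReal ?_)
    rw [Real.sq_sqrt h3.le, show 2 * (n / (2 * dw)) = n / dw by ring]
    exact hb.le_const h3 h4 ht htT x y
  · have ht' := Real.toNNReal_pos.2 ht
    have e : (fun x => (transitionKernel m p t x).real s) =
        fun x => ∫ y in s, p t.toNNReal x y ∂m := by
      ext x
      rw [measureReal_def, transitionKernel_apply hcont ht, withDensity_apply _ hs,
        integral_eq_lintegral_of_nonneg_ae (Eventually.of_forall fun y => hp0 _ ht' x y)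
        ((hcont _ ht').comp (by fun_prop : Continuous fun y => (x, y))).aestronglyMeasurable]
    rw [e]
    refine continuous_of_dominated (bound := fun _ => c₃ / t ^ (n / dw)) (fun x =>
      ((hcont _ ht').comp (by fun_prop : Continuous fun y => (x, y))).aestronglyMeasurable)
      (fun x => Eventually.of_forall fun y => ?_) ?_ (Eventually.of_forall fun y =>
      (hcont _ ht').comp (by fun_prop : Continuous fun x => (x, y)))
    · rw [Real.norm_eq_abs, abs_of_nonneg (hp0 _ ht' x y)]
      exact hb.le_const h3 h4 ht htT x y
    · exact integrableOn_const hms.ne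

/-- By `le_exp_mul` the tail is a small factor times the mass at the later time, which is at most
`1`; no integration over annuli is needed. The price is a smaller range of times. -/
lemma SubGaussianBoundsWith.hasTailBounds (hdw : 1 < dw) (h1 : 0 < c₁) (h3 : 0 < c₃)
    (h4 : 0 < c₄) (hp1 : ∀ t : ℝ≥0, 0 < t → ∀ x, ∫⁻ y, ENNReal.ofReal (p t x y) ∂m ≤ 1)
    {L : ℝ} (hL : 1 ≤ L) (hcL : c₂ / L ≤ c₄ / 2) :
    HasTailBounds (transitionKernel m p) dw
      (fun N => (N * (dw - 1)) ^ (N * (dw - 1)) * (c₄ / 2) ^ (-(N * (dw - 1))) *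
        (c₃ / c₁ * (L ^ (dw - 1)) ^ (n / dw))) (t₀ / ENNReal.ofReal (L ^ (dw - 1))) := by
  intro N hN t ht htT δ hδ x
  have hΛ : 0 < L ^ (dw - 1) := Real.rpow_pos_of_pos (by linarith) _
  have hs : MeasurableSet {y | δ ≤ dist x y} :=
    (isClosed_le continuous_const (continuous_const.dist continuous_id)).measurableSet
  have htT' : ENNReal.ofReal (L ^ (dw - 1) * t) < t₀ := by
    rw [mul_comm, ENNReal.ofReal_mul ht.le]
    exact (ENNReal.lt_div_iff_mul_lt (Or.inl (by simpa using hΛ)) (Or.inl ENNReal.ofReal_ne_top)).1 htT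
  set B := Real.exp (-(c₄ / 2 * (δ ^ dw / t) ^ (1 / (dw - 1)))) *
    (c₃ / c₁ * (L ^ (dw - 1)) ^ (n / dw)) with hB
  have hB0 : 0 ≤ B := by positivity
  have hle : transitionKernel m p t x {y | δ ≤ dist x y} ≤ ENNReal.ofReal B := by
    rw [transitionKernel_apply hcont ht, withDensity_apply _ hs]
    have hΛt := Real.toNNReal_pos.2 (mul_pos hΛ ht)
    calc _ ≤ ∫⁻ y in {y | δ ≤ dist x y},
          ENNReal.ofReal B * ENNReal.ofReal (p (L ^ (dw - 1) * t).toNNReal x y) ∂m := by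
          refine setLIntegral_mono' hs fun y hy => ?_
          rw [← ENNReal.ofReal_mul hB0]
          exact ENNReal.ofReal_le_ofReal (hb.le_exp_mul hdw h1 h3 h4 ht hL hcL htT' hδ hy)
      _ ≤ ∫⁻ y, ENNReal.ofReal B * ENNReal.ofReal (p (L ^ (dw - 1) * t).toNNReal x y) ∂m :=
          setLIntegral_le_lintegral _ _
      _ = ENNReal.ofReal B * ∫⁻ y, ENNReal.ofReal (p (L ^ (dw - 1) * t).toNNReal x y) ∂m :=
          lintegral_const_mul _ ((hcont _ hΛt).comp
            (by fun_prop : Continuous fun y => (x, y))).measurable.ennreal_ofReal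
      _ ≤ ENNReal.ofReal B * 1 := by gcongr; exact hp1 _ hΛt x
      _ = _ := mul_one _
  refine (ENNReal.toReal_le_of_le_ofReal hB0 hle).trans ?_
  have := exp_neg_rpow_le hdw (half_pos h4) (z := δ ^ dw / t) (by positivity) hN
  rw [one_div_div] at this
  calc B ≤ ((N * (dw - 1)) ^ (N * (dw - 1)) * (c₄ / 2) ^ (-(N * (dw - 1))) * (t / δ ^ dw) ^ N) *
        (c₃ / c₁ * (L ^ (dw - 1)) ^ (n / dw)) := by rw [hB]; gcongr
    _ = _ := by ring

end SubGaussian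

/-! ### Large `ε`, membership in `C₀`, and constants -/

section Main

open ProbabilityTheory

section

variable {X : Type*} [MeasurableSpace X] [TopologicalSpace X] {m : Measure X}
  {κ : ℝ → Kernel X X} {c ν : ℝ} {T T' : ℝ≥0∞}

lemma IsUltracontractive.mono (hu : IsUltracontractive m κ c ν T') (hT : T ≤ T') :
    IsUltracontractive m κ c ν T :=
  ⟨fun t ht htT => hu.le_smul t ht (htT.trans_le hT),
    fun t ht htT => hu.continuous_measure t ht (htT.trans_le hT)⟩

/-- The derivatives `Δˡ T_s g` of the solution of the heat equation with bounded initial data on a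
space of finite measure. -/
lemma IsHeatKernel.isSmoothFamily_of_isFiniteMeasure [IsFiniteMeasure m] (h : IsHeatKernel m κ)
    (hu : IsUltracontractive m κ c ν T) (hc : 0 ≤ c) {s τ R M : ℝ} (hτ : 0 < τ) (hτs : τ ≤ s / 2)
    (hτT : ENNReal.ofReal (R + τ) < T) (hR : 0 ≤ R) (hM : 0 ≤ M) {g : X → ℝ}
    (hg : StronglyMeasurable g) (hgM : ∀ᵐ x ∂m, |g x| ≤ M) :
    ∃ U : ℕ → X → ℝ, IsSmoothFamily κ U
        (fun l => c / τ ^ ν * (l.factorial / (s / 2) ^ l * (M * √(m univ).toReal))) R ∧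
      ∀ x, U 0 x = ∫ y, g y ∂κ s x := by
  have hs : 0 < s / 2 := hτ.trans_le hτs
  have hsτ : 0 < s - τ := by linarith
  have hτT' : ENNReal.ofReal τ < T := (ENNReal.ofReal_le_ofReal (by linarith)).trans_lt hτT
  have hgC : ∀ᵐ x ∂m, ‖(g x : ℂ)‖ ≤ M := by
    filter_upwards [hgM] with x hx
    simpa using hx
  have hmem : MemLp (fun x => (g x : ℂ)) 2 m :=
    MemLp.of_bound (Complex.measurable_ofReal.comp hg.measurable).aestronglyMeasurable M hgC
  set G : Lp ℂ 2 m := hmem.toLp with hG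
  have hGn : ‖G‖ ≤ M * √(m univ).toReal := by
    rw [hG, Lp.norm_toLp]
    refine ENNReal.toReal_le_of_le_ofReal (by positivity) ?_
    refine (eLpNorm_le_of_ae_bound hgC).trans_eq ?_
    rw [ENNReal.ofReal_mul hM, mul_comm, Real.sqrt_eq_rpow,
      ← ENNReal.ofReal_rpow_of_nonneg ENNReal.toReal_nonneg (by norm_num),
      ENNReal.ofReal_toReal (measure_ne_top m univ)]
    norm_num
  have hterm : ∀ l : ℕ, c / τ ^ ν * (l.factorial / (s - τ) ^ l * ‖G‖) ≤
      c / τ ^ ν * (l.factorial / (s / 2) ^ l * (M * √(m univ).toReal)) := by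
    intro l
    have : s / 2 ≤ s - τ := by linarith
    gcongr
  refine ⟨fun l => smoothed h l τ (s - τ) G, ⟨fun l => h.continuous_smoothed hu hc hτ hτT' l _ _,
    fun l x => ?_, fun l r hr hrR x => ?_⟩, fun x => ?_⟩
  · exact (h.abs_smoothed_le hu hc hτ hτT' l hsτ _ x).trans (hterm l)
  · refine (h.abs_integral_smoothed_sub_le hu hc hτ hτT' l hsτ hr
      ((ENNReal.ofReal_le_ofReal (by linarith)).trans_lt hτT) _ x).trans ?_
    exact mul_le_mul_of_nonneg_left (hterm (l + 2)) (sq_nonneg r)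
  · have e : τ + (s - τ) = s := by ring
    have := h.smoothed_zero hτ hsτ hmem x (by
      rw [e]; exact h.integrable_of_ae_bound (by linarith) hg hgM x)
    rwa [e] at this

end

variable {X : Type*} [MetricSpace X] [ProperSpace X] [MeasurableSpace X] [BorelSpace X]

/-- By locality every `U l` vanishes off the closed `ε`-thickening of `K`, which is compact because
`X` is proper. -/
lemma IsSmoothFamily.exists_zeroAtInfty {κ : ℝ → Kernel X X}
    (hκ : ∀ t, 0 < t → IsFiniteKernel (κ t))
    {dw : ℝ} {a : ℝ → ℝ} {T : ℝ≥0∞} (hT : 0 < T) (ha : HasTailBounds κ dw a T)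
    {U : ℕ → X → ℝ} {b : ℕ → ℝ} {R : ℝ} (hR : 0 < R) (hU : IsSmoothFamily κ U b R)
    {Ω : Type*} [MeasurableSpace Ω] (Z : Diffusion X Ω)
    (hZ : ∀ (t : ℝ≥0) (f : X → ℝ), 0 < t → Measurable f → ∀ x,
      Z.semigroup t f x = ∫ y, f y ∂κ t x)
    {K : Set X} (hK : IsCompact K) (hKne : K.Nonempty) {ε : ℝ} (hε : 0 < ε)
    (h0 : ∀ x, ε ≤ Metric.infDist x K → U 0 x = 0) :
    ∃ F : ℕ → C₀(X, ℝ), (∀ l x, F l x = U l x) ∧ (∀ l, ‖F l‖ ≤ b l) ∧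
      ∀ l, Z.HasGeneratorPow l (F 0) (F l) := by
  have hV : IsOpen {x | ε < Metric.infDist x K} :=
    isOpen_lt continuous_const (Metric.continuous_infDist_pt K)
  have hzero := hU.eq_zero_of_infDist hκ hT ha hR hV (fun x hx => h0 x (le_of_lt hx))
  have hcs : ∀ l, HasCompactSupport (U l) := by
    intro l
    refine HasCompactSupport.intro (hK.cthickening (r := ε)) fun x hx => hzero l x ?_
    by_contra hx'
    exact hx (Metric.mem_cthickening_iff.2 ((ENNReal.le_ofReal_iff_toReal_le
      (Metric.infEDist_ne_top hKne) hε.le).2 (not_lt.1 hx')))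
  let F : ℕ → C₀(X, ℝ) := fun l => ⟨⟨U l, hU.continuous l⟩, (hcs l).is_zero_at_infty⟩
  have hF : ∀ l x, F l x = U l x := fun l x => rfl
  obtain ⟨x₀, -⟩ := hKne
  refine ⟨F, hF, fun l => ?_, fun l => hU.hasGeneratorPow hR Z hZ F hF l⟩
  rw [← ZeroAtInftyContinuousMap.norm_toBCF_eq_norm,
    BoundedContinuousFunction.norm_le ((abs_nonneg _).trans (hU.abs_le l x₀))]
  exact fun x => hU.abs_le l x

omit [ProperSpace X] [BorelSpace X] in
lemma Diffusion.hasGeneratorPow_zero {Ω : Type*} [MeasurableSpace Ω] (Z : Diffusion X Ω) (l : ℕ) :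
    Z.HasGeneratorPow l 0 0 := by
  induction l with
  | zero => rfl
  | succ l ih =>
    refine ⟨0, ih, ?_⟩
    rw [Diffusion.HasGenerator, Metric.tendstoUniformly_iff]
    intro ε hε
    refine Eventually.of_forall fun t x => ?_
    have : Z.semigroup t (0 : C₀(X, ℝ)) x = 0 := by
      refine integral_eq_zero_of_ae (Eventually.of_forall fun ω => ?_)
      change (Z.path t ω).elim 0 (0 : C₀(X, ℝ)) = (0 : ℝ)
      cases Z.path t ω using OnePoint.rec <;> simp
    rw [this]
    simpa using hε

-- With `D` the diameter of a bounded `X`, choose `q` so that `q (2D + 1)^dw < T`, which settles `ε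
-- ≤ D + 1`. For larger `ε` all distances are below `ε`. If `X` is unbounded, times are
-- unrestricted.
omit [MeasurableSpace X] [BorelSpace X] in
lemma exists_scale {T : ℝ≥0∞} (hT : 0 < T)
    (hTtop : ¬ Bornology.IsBounded (univ : Set X) → T = ∞) {dw : ℝ} (hdw : 0 < dw) :
    ∃ q : ℝ, 0 < q ∧ ∀ K : Set X, IsCompact K → ∀ ε : ℝ, 0 < ε →
      ENNReal.ofReal (q * (Metric.diam K + ε) ^ dw) < T ∨
        (1 ≤ ε ∧ CompactSpace X ∧ ∀ x y : X, dist x y < ε) := by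
  by_cases hb : Bornology.IsBounded (univ : Set X)
  · obtain ⟨t, ht, htT⟩ := ENNReal.lt_iff_exists_real_btwn.1 hT
    have ht0 : 0 < t := ENNReal.ofReal_pos.1 htT.1
    set D := Metric.diam (univ : Set X)
    have hD : 0 ≤ D := Metric.diam_nonneg
    have hpos : 0 < (2 * D + 1) ^ dw := by positivity
    refine ⟨t / (2 * D + 1) ^ dw, by positivity, fun K hK ε hε => ?_⟩
    by_cases hεD : ε ≤ D + 1
    · left
      refine lt_of_le_of_lt (ENNReal.ofReal_le_ofReal ?_) htT.2
      have hdK : Metric.diam K ≤ D := Metric.diam_mono (subset_univ K) hb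
      have hdK0 : 0 ≤ Metric.diam K := Metric.diam_nonneg
      calc t / (2 * D + 1) ^ dw * (Metric.diam K + ε) ^ dw
          ≤ t / (2 * D + 1) ^ dw * (2 * D + 1) ^ dw := by
            have : Metric.diam K + ε ≤ 2 * D + 1 := by linarith
            gcongr
        _ = t := div_mul_cancel₀ _ hpos.ne'
    · right
      refine ⟨by linarith, ⟨Metric.isCompact_of_isClosed_isBounded isClosed_univ hb⟩, fun x y => ?_⟩
      have := Metric.dist_le_diam_of_mem hb (mem_univ x) (mem_univ y)
      linarith
  · refine ⟨1, one_pos, fun K _ ε _ => Or.inl ?_⟩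
    rw [hTtop hb]
    exact ENNReal.ofReal_lt_top

/-- With `ν = n / (2 dw)`, the power `(τ / 2)^(ν + l)` contributes `ε^(l dw + n/2)`, and `√V`
contributes `R^(n/2)`; the rest depends only on `Q`, `l` and fixed constants. -/
lemma smoothBound_le {n dw c q Q ε R M V v τ : ℝ} {a : ℝ → ℝ} (ha0 : ∀ N, 0 ≤ a N) (hc : 0 ≤ c)
    (hn : 0 < n) (hdw : 0 < dw) (hq : 0 < q) (hε : 0 < ε) (hR : 0 < R) (hM : 0 ≤ M) (hQ : 0 < Q)
    (hv : 0 ≤ v) (hV : V ≤ v * R ^ n) (hτ : τ = ε ^ dw * min (1 / (2 * Q)) q) (l : ℕ) :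
    smoothBound c (n / (2 * dw)) dw q a τ M V l ≤
      smoothBound c (n / (2 * dw)) dw q a (min (1 / (2 * Q)) q) 1 v l *
        R ^ (n / 2) / ε ^ ((l : ℝ) * dw + n / 2) * M := by
  set μ := min (1 / (2 * Q)) q with hμ
  have hμ0 : 0 < μ := lt_min (by positivity) hq
  set ν := n / (2 * dw) with hν
  have hν0 : 0 ≤ ν := by positivity
  set A := 1 + a (4 * (ν + l) + 2) * (q / (((1 : ℝ) / 2) ^ dw) ^ 4) ^ (4 * (ν + l) + 2) with hA
  have hA0 : 0 ≤ A := by have := ha0 (4 * (ν + l) + 2); positivity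
  have hθ : 0 ≤ (1 - ((1 : ℝ) / 2) ^ dw)⁻¹ :=
    inv_nonneg.2 (sub_nonneg.2 (Real.rpow_le_one (by norm_num) (by norm_num) hdw.le))
  have e1 : (τ / 2) ^ (ν + l) = ε ^ ((l : ℝ) * dw + n / 2) * (μ / 2) ^ (ν + l) := by
    rw [hτ, mul_div_assoc, Real.mul_rpow (by positivity) (by positivity), ← Real.rpow_mul hε.le]
    congr 2
    rw [hν]; field_simp; ring
  have e2 : √(A * V) ≤ √(A * v) * R ^ (n / 2) := by
    have : R ^ (n / 2) = √(R ^ n) := by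
      rw [Real.sqrt_eq_rpow, ← Real.rpow_mul hR.le]; ring_nf
    rw [this, ← Real.sqrt_mul (by positivity)]
    apply Real.sqrt_le_sqrt
    rw [mul_assoc]
    gcongr
  unfold smoothBound
  rw [e1, ← hA]
  calc _ ≤ c * l.factorial / (ε ^ ((l : ℝ) * dw + n / 2) * (μ / 2) ^ (ν + l)) *
        (2 * M * (√(A * v) * R ^ (n / 2))) * (1 - ((1 : ℝ) / 2) ^ dw)⁻¹ := by gcongr
    _ = _ := by field_simp

lemma smoothBound_nonneg {c ν dw q τ V : ℝ} {a : ℝ → ℝ} (hc : 0 ≤ c) (hdw : 0 < dw)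
    (hτ : 0 ≤ τ) (l : ℕ) : 0 ≤ smoothBound c ν dw q a τ 1 V l := by
  have hθ : 0 ≤ (1 - ((1 : ℝ) / 2) ^ dw)⁻¹ :=
    inv_nonneg.2 (sub_nonneg.2 (Real.rpow_le_one (by norm_num) (by norm_num) hdw.le))
  unfold smoothBound
  positivity

/-- Since `ε ≥ 1`, `min (1 / (2Q)) t₁` bounds `τ` from below, and `R / ε ≥ 1` supplies the factor of
the required shape. -/
lemma finiteMeasureBound_le {n dw c Q ε R M V s τ t₁ : ℝ} (hc : 0 ≤ c) (hn : 0 < n) (hdw : 0 < dw)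
    (ht₁ : 0 < t₁) (hε : 1 ≤ ε) (hεR : ε ≤ R) (hM : 0 ≤ M) (hs : 0 < s)
    (hQ : Q = ε ^ dw / s) (hτ : τ = min (s / 2) t₁) (l : ℕ) :
    c / τ ^ (n / (2 * dw)) * (l.factorial / (s / 2) ^ l * (M * √V)) ≤
      c / (min (1 / (2 * Q)) t₁) ^ (n / (2 * dw)) * (l.factorial * (2 * Q) ^ l * √V) *
        R ^ (n / 2) / ε ^ ((l : ℝ) * dw + n / 2) * M := by
  have hε0 : 0 < ε := by linarith
  have hR0 : 0 < R := by linarith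
  have hεd : 1 ≤ ε ^ dw := Real.one_le_rpow hε hdw.le
  have hQ0 : 0 < Q := by rw [hQ]; positivity
  have hs2 : s / 2 = ε ^ dw / (2 * Q) := by rw [hQ]; field_simp
  have hτ' : min (1 / (2 * Q)) t₁ ≤ τ := by
    rw [hτ, hs2]; gcongr
  have hm0 : 0 < min (1 / (2 * Q)) t₁ := lt_min (by positivity) ht₁
  have e1 : 1 / (s / 2) ^ l = (2 * Q) ^ l / ε ^ ((l : ℝ) * dw) := by
    rw [hs2, mul_comm (l : ℝ), Real.rpow_mul hε0.le, Real.rpow_natCast, div_pow, one_div_div]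
  have e2 : 1 ≤ R ^ (n / 2) / ε ^ (n / 2) := by
    rw [one_le_div (by positivity)]
    gcongr
  calc c / τ ^ (n / (2 * dw)) * (l.factorial / (s / 2) ^ l * (M * √V))
      = c / τ ^ (n / (2 * dw)) * (l.factorial * (1 / (s / 2) ^ l) * (M * √V)) * 1 := by ring
    _ ≤ c / (min (1 / (2 * Q)) t₁) ^ (n / (2 * dw)) *
        (l.factorial * (1 / (s / 2) ^ l) * (M * √V)) * (R ^ (n / 2) / ε ^ (n / 2)) := by
        gcongr
    _ = _ := by
        rw [e1, Real.rpow_add hε0]; field_simp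

omit [ProperSpace X] [MeasurableSpace X] [BorelSpace X] in
lemma dist_le_diam_add {K : Set X} (hK : IsCompact K) {x₀ y : X} (hx₀ : x₀ ∈ K) {ε : ℝ}
    (hy : Metric.infDist y K < ε) : dist x₀ y ≤ Metric.diam K + ε := by
  obtain ⟨z, hz, hyz⟩ := (Metric.infDist_lt_iff ⟨x₀, hx₀⟩).1 hy
  have h1 := Metric.dist_le_diam_of_mem hK.isBounded hx₀ hz
  have h2 := dist_triangle x₀ z y
  rw [dist_comm y z] at hyz
  linarith

lemma SubGaussianBounds.exists_constants {X : Type*} [MetricSpace X] {n dw : ℝ}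
    {p : ℝ≥0 → X → X → ℝ} (h : SubGaussianBounds n dw p) :
    ∃ (c₁ c₂ c₃ c₄ : ℝ) (t₀ : ℝ≥0∞), 0 < c₁ ∧ 0 < c₂ ∧ 0 < c₃ ∧ 0 < c₄ ∧ 0 < t₀ ∧
      (¬ Bornology.IsBounded (Set.univ : Set X) → t₀ = ∞) ∧
      SubGaussianBoundsWith n dw p c₁ c₂ c₃ c₄ t₀ := by
  obtain ⟨c₁, c₂, c₃, c₄, t₀, h1, h2, h3, h4, h0, htop, hb⟩ := h
  refine ⟨c₁, c₂, c₃, c₄, t₀, h1, h2, h3, h4, h0, htop, fun t ht htT x y => ?_⟩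
  have := hb t.toNNReal (Real.toNNReal_pos.2 ht) htT x y
  rwa [Real.coe_toNNReal t ht.le] at this

-- Balls are finite by `measure_le`. Through this `m` becomes s-finite, as the kernel constructions
-- require.
omit [ProperSpace X] in
lemma SubGaussianBoundsWith.isLocallyFiniteMeasure {n dw c₁ c₂ c₃ c₄ : ℝ} {t₀ : ℝ≥0∞}
    {p : ℝ≥0 → X → X → ℝ} (hb : SubGaussianBoundsWith n dw p c₁ c₂ c₃ c₄ t₀) {m : Measure X}
    (h0 : 0 < t₀) (h1 : 0 < c₁) (h2 : 0 < c₂) (hdw : 1 < dw)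
    (hp1 : ∀ t : ℝ≥0, 0 < t → ∀ x, ∫⁻ y, ENNReal.ofReal (p t x y) ∂m ≤ 1) :
    IsLocallyFiniteMeasure m := by
  obtain ⟨t, -, htT⟩ := ENNReal.lt_iff_exists_real_btwn.1 h0
  refine ⟨fun x => ⟨Metric.ball x 1, Metric.ball_mem_nhds x one_pos, ?_⟩⟩
  refine (hb.measure_le h1 h2 hdw (ENNReal.ofReal_pos.1 htT.1) htT.2 hp1 (x := x) (R := 1)
    Metric.isOpen_ball.measurableSet fun y hy => ?_).trans_lt ENNReal.ofReal_lt_top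
  rw [dist_comm]
  exact (Metric.mem_ball.1 hy).le

omit [ProperSpace X] [BorelSpace X] [MetricSpace X] in
lemma ae_abs_le_norm {m : Measure X} (g : Lp ℝ ∞ m) : ∀ᵐ x ∂m, |g x| ≤ ‖g‖ := by
  have h : ∀ᵐ x ∂m, ‖g x‖ₑ ≤ eLpNormEssSup g m := ae_le_eLpNormEssSup
  filter_upwards [h] with x hx
  rw [← eLpNorm_exponent_top] at hx
  have := ENNReal.toReal_mono (Lp.eLpNorm_ne_top g) hx
  rwa [toReal_enorm, ← Lp.norm_def] at this

end Main

/-! ### Assembly -/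

theorem theoremA1 {X : Type*} [MetricSpace X] [ProperSpace X] [MeasurableSpace X] [BorelSpace X]
    (m : Measure X) [m.IsOpenPosMeasure] {Ω : Type*} [MeasurableSpace Ω]
    (n dw : ℝ) (hn : 0 < n) (hdw : 2 ≤ dw) (hX : AhlforsRegular m n)
    (Z : Diffusion X Ω) (p : ℝ≥0 → X → X → ℝ) (hp : Z.IsTransitionDensity m p)
    (hsymm : ∀ t : ℝ≥0, 0 < t → ∀ x y, p t x y = p t y x)
    (hcont : ∀ t : ℝ≥0, 0 < t → Continuous fun z : X × X => p t z.1 z.2)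
    (hbounds : SubGaussianBounds n dw p) :
    ∃ c : ℕ → ℝ → ℝ, ∀ K : Set X, IsCompact K → ∀ ε : ℝ, 0 < ε → ∀ s : ℝ≥0, 0 < s →
      ∀ g : Lp ℝ ∞ m, ∃ f : C₀(X, ℝ),
        (∀ x ∈ K, f x = Z.semigroup s g x) ∧
        (∀ x, ENNReal.ofReal ε ≤ Metric.infEDist x K → f x = 0) ∧
        ‖f‖ ≤ ‖g‖ ∧
        (0 ≤ᵐ[m] g → ∀ x, 0 ≤ f x) ∧
        ∀ l : ℕ, 0 < l → ∃ u : C₀(X, ℝ), Z.HasGeneratorPow l f u ∧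
          ‖u‖ ≤ c l (ε ^ dw / (s : ℝ)) * (Metric.diam K + ε) ^ (n / 2) /
            ε ^ ((l : ℝ) * dw + n / 2) * ‖g‖ := by
  have hdw1 : 1 < dw := by linarith
  have hdw0 : 0 < dw := by linarith
  obtain ⟨c₁, c₂, c₃, c₄, t₀, h1, h2, h3, h4, ht₀, htop, hb⟩ := hbounds.exists_constants
  have hp1 : ∀ t : ℝ≥0, 0 < t → ∀ x, ∫⁻ y, ENNReal.ofReal (p t x y) ∂m ≤ 1 :=
    fun t ht x => Z.withDensity_univ_le hp ht x
  have hloc := hb.isLocallyFiniteMeasure ht₀ h1 h2 hdw1 hp1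
  set κ := transitionKernel m p with hκ
  have h : IsHeatKernel m κ := Z.isHeatKernel hcont hp hsymm
  have hZ : ∀ (t : ℝ≥0) (f : X → ℝ), 0 < t → Measurable f → ∀ x,
      Z.semigroup t f x = ∫ y, f y ∂κ t x := by
    intro t f ht hf x
    rw [Z.semigroup_eq_integral hp ht x hf, hκ, transitionKernel_apply hcont (by exact_mod_cast ht),
      Real.toNNReal_coe]
  -- the constant in the comparison of the two sub-Gaussian exponents
  set L := max 1 (2 * c₂ / c₄) with hL
  have hL1 : 1 ≤ L := le_max_left _ _
  have hcL : c₂ / L ≤ c₄ / 2 := by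
    have : 2 * c₂ / c₄ ≤ L := le_max_right _ _
    rw [div_le_iff₀ h4] at this
    rw [div_le_iff₀ (by linarith)]
    linarith
  have hΛ : 1 ≤ L ^ (dw - 1) := Real.one_le_rpow hL1 (by linarith)
  set T := t₀ / ENNReal.ofReal (L ^ (dw - 1)) with hT
  have hT0 : 0 < T := ENNReal.div_pos ht₀.ne' ENNReal.ofReal_ne_top
  have hTt₀ : T ≤ t₀ := by
    refine ENNReal.div_le_of_le_mul (le_mul_of_one_le_right' ?_)
    simpa using hΛ
  have hTtop : ¬ Bornology.IsBounded (univ : Set X) → T = ∞ := fun hX' => by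
    rw [hT, htop hX', ENNReal.top_div_of_ne_top ENNReal.ofReal_ne_top]
  have hu : IsUltracontractive m κ (√c₃) (n / (2 * dw)) T :=
    (hb.isUltracontractive hcont h3 h4 hp.nonneg).mono hTt₀
  have ha := hb.hasTailBounds hcont hdw1 h1 h3 h4 hp1 hL1 hcL
  -- The absolute value only provides nonnegativity at orders `N ≤ 0`, where the tail bounds say
  -- nothing.
  set a : ℝ → ℝ := fun N => |(N * (dw - 1)) ^ (N * (dw - 1)) * (c₄ / 2) ^ (-(N * (dw - 1))) *
    (c₃ / c₁ * (L ^ (dw - 1)) ^ (n / dw))| with hadef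
  have ha0 : ∀ N, 0 ≤ a N := fun N => abs_nonneg _
  replace ha : HasTailBounds κ dw a T := fun N hN t ht htT δ hδ x =>
    (ha N hN t ht htT δ hδ x).trans (mul_le_mul_of_nonneg_right (le_abs_self _) (by positivity))
  have hκfin : ∀ t, 0 < t → ProbabilityTheory.IsFiniteKernel (κ t) := fun t ht => h.isFiniteKernel ht
  obtain ⟨q, hq, hscale⟩ := exists_scale (X := X) hT0 hTtop hdw0
  obtain ⟨t₁, -, ht₁T⟩ := ENNReal.lt_iff_exists_real_btwn.1 hT0
  have ht₁ : 0 < t₁ := ENNReal.ofReal_pos.1 ht₁T.1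
  set v := q ^ (n / dw) / c₁ * Real.exp (c₂ * (1 / q) ^ (1 / (dw - 1))) with hv
  have hv0 : 0 ≤ v := by positivity
  set cA : ℕ → ℝ → ℝ := fun l Q =>
    smoothBound (√c₃) (n / (2 * dw)) dw q a (min (1 / (2 * Q)) q) 1 v l with hcA
  set cB : ℕ → ℝ → ℝ := fun l Q => √c₃ / (min (1 / (2 * Q)) (t₁ / 2)) ^ (n / (2 * dw)) *
    (l.factorial * (2 * Q) ^ l * √(m univ).toReal) with hcB
  have hcA0 : ∀ l Q, 0 < Q → 0 ≤ cA l Q := fun l Q hQ =>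
    smoothBound_nonneg (Real.sqrt_nonneg _) hdw0 (le_min (by positivity) hq.le) l
  have hcB0 : ∀ l Q, 0 < Q → 0 ≤ cB l Q := fun l Q hQ => by
    have : 0 ≤ min (1 / (2 * Q)) (t₁ / 2) := le_min (by positivity) (by positivity)
    positivity
  -- `cA` serves the cut-off construction, `cB` the case of large `ε` on compact `X`.
  refine ⟨fun l Q => cA l Q + cB l Q, fun K hK ε hε s hs g => ?_⟩
  have hs0 : (0 : ℝ) < s := by exact_mod_cast hs
  have hQ0 : 0 < ε ^ dw / (s : ℝ) := by positivity
  have hdiam : 0 ≤ Metric.diam K := Metric.diam_nonneg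
  have hR0 : 0 < Metric.diam K + ε := by linarith
  -- The empty set is separate because `infDist` to it is `0`, while `infEDist` is infinite.
  rcases K.eq_empty_or_nonempty with rfl | hKne
  · refine ⟨0, by simp, by simp, by simp, by simp, fun l _ =>
      ⟨0, Z.hasGeneratorPow_zero l, ?_⟩⟩
    rw [norm_zero]
    have := hcA0 l _ hQ0
    have := hcB0 l _ hQ0
    positivity
  have hg : StronglyMeasurable (g : X → ℝ) := Lp.stronglyMeasurable g
  have hgM := ae_abs_le_norm g
  have hfinish : ∀ (U : ℕ → X → ℝ) (b : ℕ → ℝ) (R : ℝ), 0 < R → IsSmoothFamily κ U b R →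
      (∀ x ∈ K, U 0 x = ∫ y, g y ∂κ s x) → (∀ x, ε ≤ Metric.infDist x K → U 0 x = 0) →
      (∀ x, |U 0 x| ≤ ‖g‖) → (0 ≤ᵐ[m] g → ∀ x, 0 ≤ U 0 x) →
      (∀ l, b l ≤ (cA l (ε ^ dw / (s : ℝ)) + cB l (ε ^ dw / (s : ℝ))) *
        (Metric.diam K + ε) ^ (n / 2) / ε ^ ((l : ℝ) * dw + n / 2) * ‖g‖) →
      ∃ f : C₀(X, ℝ),
        (∀ x ∈ K, f x = Z.semigroup s g x) ∧
        (∀ x, ENNReal.ofReal ε ≤ Metric.infEDist x K → f x = 0) ∧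
        ‖f‖ ≤ ‖g‖ ∧
        (0 ≤ᵐ[m] g → ∀ x, 0 ≤ f x) ∧
        ∀ l : ℕ, 0 < l → ∃ u : C₀(X, ℝ), Z.HasGeneratorPow l f u ∧
          ‖u‖ ≤ (cA l (ε ^ dw / (s : ℝ)) + cB l (ε ^ dw / (s : ℝ))) *
            (Metric.diam K + ε) ^ (n / 2) / ε ^ ((l : ℝ) * dw + n / 2) * ‖g‖ := by
    intro U b R hR hU hUK hUout hUM hUnn hbl
    obtain ⟨F, hF, hFn, hFgen⟩ := hU.exists_zeroAtInfty hκfin hT0 ha hR Z hZ hK hKne hε hUout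
    refine ⟨F 0, fun x hx => ?_, fun x hx => ?_, ?_, fun hg0 x => ?_, fun l _ =>
      ⟨F l, hFgen l, (hFn l).trans (hbl l)⟩⟩
    · rw [hF, hUK x hx, hZ s _ hs hg.measurable]
    · rw [hF, hUout x ((ENNReal.ofReal_le_iff_le_toReal (Metric.infEDist_ne_top hKne)).1 hx)]
    · rw [← ZeroAtInftyContinuousMap.norm_toBCF_eq_norm,
        BoundedContinuousFunction.norm_le (norm_nonneg g)]
      intro x
      exact (congrArg abs (hF 0 x)).trans_le (hUM x)
    · rw [hF]
      exact hUnn hg0 x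
  have hratio : 0 ≤ (Metric.diam K + ε) ^ (n / 2) := by positivity
  rcases hscale K hK ε hε with hsmall | ⟨hε1, hcomp, hdist⟩
  · set R := Metric.diam K + ε with hRdef
    have hqR : 0 < q * R ^ dw := by positivity
    set W := {x | Metric.infDist x K < ε} with hW
    have hWm : MeasurableSet W :=
      (isOpen_lt (Metric.continuous_infDist_pt K) continuous_const).measurableSet
    obtain ⟨x₀, hx₀⟩ := id hKne
    -- At time `q * R ^ dw` the exponent is the constant `1 / q`, so `v` is independent of `K` and
    -- `ε`.
    have hWle : m W ≤ ENNReal.ofReal (v * R ^ n) := by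
      refine (hb.measure_le h1 h2 hdw1 hqR (hsmall.trans_le hTt₀) hp1 hWm
        (fun y hy => dist_le_diam_add hK hx₀ hy)).trans_eq ?_
      congr 1
      have e1 : R ^ dw / (q * R ^ dw) = 1 / q := by field_simp
      have e2 : (q * R ^ dw) ^ (n / dw) = q ^ (n / dw) * R ^ n := by
        rw [Real.mul_rpow hq.le (by positivity), ← Real.rpow_mul hR0.le]
        congr 2
        field_simp
      rw [← hRdef, e1, e2, hv]
      ring
    -- The first entry keeps `τ < s`; the second controls the tails and keeps `τ` below `T`.
    set τ := min ((s : ℝ) / 2) (q * ε ^ dw) with hτ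
    have hτ0 : 0 < τ := lt_min (by positivity) (by positivity)
    have hτq : τ ≤ q * ε ^ dw := min_le_right _ _
    have hτT : ENNReal.ofReal τ < T := by
      refine (ENNReal.ofReal_le_ofReal (hτq.trans ?_)).trans_lt hsmall
      have : ε ≤ R := by linarith
      gcongr
    have hτs : τ < s := (min_le_left _ _).trans_lt (by linarith)
    obtain ⟨U, hU, hUK, hUout, hUM, hUnn⟩ := exists_smooth_cutoff h hu (Real.sqrt_nonneg _)
      (by positivity) hdw0 ha ha0 (K := K) hε hτ0 hτs hτT hτq (norm_nonneg g) hg hgM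
      (hWle.trans_lt ENNReal.ofReal_lt_top)
    refine hfinish U _ _ (half_pos hτ0) hU hUK hUout hUM hUnn fun l => ?_
    have hτ' : τ = ε ^ dw * min (1 / (2 * (ε ^ dw / (s : ℝ)))) q := by
      rw [hτ, mul_min_of_nonneg _ _ (by positivity : (0 : ℝ) ≤ ε ^ dw), mul_comm q]
      congr 1
      field_simp
    refine (smoothBound_le ha0 (Real.sqrt_nonneg _) hn hdw0 hq hε hR0 (norm_nonneg g) hQ0 hv0
      (ENNReal.toReal_le_of_le_ofReal (by positivity) hWle) hτ' l).trans ?_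
    have := hcB0 l _ hQ0
    gcongr
    exact le_add_of_nonneg_right this
  -- Every point is within `ε` of `K`, so the support condition is vacuous and `f = T_s g` works.
  · have hfinm : IsFiniteMeasure m := ⟨isCompact_univ.measure_lt_top⟩
    set τ := min ((s : ℝ) / 2) (t₁ / 2) with hτ
    have hτ0 : 0 < τ := lt_min (by positivity) (by positivity)
    obtain ⟨U, hU, hUeq⟩ := h.isSmoothFamily_of_isFiniteMeasure hu (Real.sqrt_nonneg _) hτ0
      (min_le_left _ _) (R := t₁ / 2) ((ENNReal.ofReal_le_ofReal (by
        linarith [min_le_right ((s : ℝ) / 2) (t₁ / 2)])).trans_lt ht₁T.2) (by positivity)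
      (norm_nonneg g) hg hgM
    refine hfinish U _ _ (half_pos ht₁) hU (fun x _ => hUeq x) (fun x hx => ?_) (fun x => ?_)
      (fun hg0 x => ?_) fun l => ?_
    · obtain ⟨z, hz⟩ := id hKne
      have := Metric.infDist_le_dist_of_mem (x := x) hz
      linarith [hdist x z]
    · rw [hUeq]
      exact h.abs_integral_le_of_ae hs0 (norm_nonneg g) hgM x
    · rw [hUeq]
      exact integral_nonneg_of_ae ((h.ac s hs0 x).ae_le hg0)
    · refine (finiteMeasureBound_le (Real.sqrt_nonneg _) hn hdw0 (half_pos ht₁) hε1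
        (by linarith : ε ≤ Metric.diam K + ε) (norm_nonneg g) hs0 rfl hτ l).trans ?_
      have := hcA0 l _ hQ0
      gcongr
      exact le_add_of_nonneg_left this
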